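/- Setting. Let $n\ge 2$ and let $f_1,\dots,f_n:\mathbb R^d\to\mathbb R$ be differentiable, each $L$-smooth ($\|\nabla f_k(u)-\nabla f_k(v)\|\le L\|u-v\|$) and $\mu$-strongly convex ($f_k(v)-f_k(u)\ge\langle\nabla f_k(u),v-u\rangle+\frac\mu2\|v-u\|^2$), with $\mu>0$. Let $\hat W\in\mathbb R^{n\times n}$ be a gossip matrix of a communication network: symmetric positive semidefinite, with kernel spanned by $(1,\dots,1)^\top$, and with $\hat w_{ij}\ne0$ if and only if $i=j$ or $(i,j)$ is an edge. Put $W=\hat W\otimes I_d$, let $\lambda_{\max}(W)$ and $\lambda^+_{\min}(W)$ be its largest and its smallest positive eigenvalue and $\chi=\lambda_{\max}(W)/\lambda^+_{\min}(W)$. For $\lambda>0$ let $x^*$ be the minimizer of the penalized objective $$F(x)=\frac1n\sum_{k=1}^n f_k(x_k)+\frac\lambda2\langle x,Wx\rangle,\qquad x=[x_1,\dots,x_n]\in\mathbb R^{nd},$$ and let $z_0\ne x^*$. Write $L_f=L/n$ and $\mu_f=\mu/n$ (the smoothness and strong convexity constants of $\frac1n\sum_k f_k(x_k)$) and $L_p=\lambda\lambda_{\max}(W)$.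 Method. Write $F=\varphi+\psi$, where $\varphi$ is the sum $\frac1n\sum_k f_k(x_k)$ and $\psi$ the penalty $\frac\lambda2\langle x,Wx\rangle$ if $L_f\le L_p$, and the other way round if $L_f>L_p$. Put $H=2\min\{L_f,L_p\}$ and $N=\max\{\lceil 2\sqrt{8H/\mu_f}\rceil,1\}$. The Accelerated Meta-Algorithm ($p=1$) starts from $y_0=z_0$, $A_0=0$ and iterates, with $\eta=\frac1{2H}$, $a_{k+1}=\frac{\eta+\sqrt{\eta^2+4\eta A_k}}2$, $A_{k+1}=A_k+a_{k+1}$, $w_k=\frac{A_k}{A_{k+1}}y_k+\frac{a_{k+1}}{A_{k+1}}z_k$, $$y_{k+1}\approx\arg\min_y\Big\{\varphi(w_k)+\langle\nabla\varphi(w_k),y-w_k\rangle+\psi(y)+\frac H2\|y-w_k\|^2\Big\},\qquad z_{k+1}=z_k-a_{k+1}\nabla\varphi(y_{k+1})-a_{k+1}\nabla\psi(y_{k+1}),$$ where the auxiliary problem is solved with accuracy $\delta$, i.e. the squared distance of $y_{k+1}$ to its exact minimizer is at most $\delta$. Its output after $N$ iterations is $y_N$; the restarted method applies it $s$ times in succession,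 each time from the previous output. The auxiliary problems are treated by $T$ steps of Nesterov's accelerated gradient method with constant momentum, started at $w_k-\nabla\varphi(w_k)/H$, with constants $H+L_p$ and $H+\lambda\lambda^+_{\min}(W)$ if $\psi$ is the penalty, and $H+L_f$ and $H+\mu_f$ if $\psi$ is the sum. One communication is one multiplication of a vector by $W$; one local gradient call is one evaluation of the gradients $\nabla f_k(x_k)$, one at each node $k$. Theorem. There is an absolute constant $C>0$ such that for all such data there is $\varepsilon_0>0$ such that for every $0<\varepsilon\le\varepsilon_0$ the following holds with $$\delta=\frac{\varepsilon\mu_f}{864^2\,(L_f+\lambda\lambda_{\max}(W)+H)^2}.$$ There are a number $s\ge1$ of restarts and a number $T$ of inner steps such that (i) every run of the restarted Accelerated Meta-Algorithm from $z_0$ with $s$ restarts in which all auxiliary problems are solved with accuracy $\delta$, by whatever means, returns an $\varepsilon$-solution, that is, a point $x$ with $F(x)-F(x^*)\le\varepsilon$; (ii) the method with $T$ inner steps solves all its auxiliary problems with accuracy $\delta$, and so returns an $\varepsilon$-solution, and the numbers of its communications and of its local gradient calls satisfy $$N^{comm}\le C\,\min\Big\{\sqrt{\frac{\lambda\lambda_{\max}(W)}{\mu/n}},\sqrt{\frac{L}{\mu}\chi}\Big\}\,\log\frac{\|z_0-x^*\|^2}{\varepsilon}\,\log\frac1\delta,\qquad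 N^{loc}\le C\sqrt{\frac L\mu}\,\log\frac{\|z_0-x^*\|^2}{\varepsilon}\,\log\frac1\delta .$$ -/

import Mathlib

open scoped Gradient RealInnerProductSpace

namespace PFL

noncomputable section

/-- `ℝ^{nd}`: stacked vectors `x = [x_1, …, x_n]` with blocks `x k ∈ ℝ^d` and the `ℓ₂`-norm. -/
abbrev Stacked (n d : ℕ) : Type := PiLp 2 (fun _ : Fin n => EuclideanSpace ℝ (Fin d))

/-! ### Gossip matrices and the communication operator -/

/-- `What` is a gossip matrix of the communication network `G`: symmetric positive semidefinite,
its kernel is the line spanned by `(1, …, 1)`, and its non-zero entries are exactly the diagonal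
ones and those on the edges of `G`. -/
structure IsGossip {n : ℕ} (G : SimpleGraph (Fin n)) (What : Matrix (Fin n) (Fin n) ℝ) : Prop where
  posSemidef : What.PosSemidef
  kernel : ∀ v : Fin n → ℝ, What.mulVec v = 0 ↔ ∃ c : ℝ, v = fun _ => c
  support : ∀ i j, What i j ≠ 0 ↔ i = j ∨ G.Adj i j

/-- `W = What ⊗ I_d`, acting on stacked vectors: `(W x)_i = ∑ j, What i j • x_j`. -/
def commOp {n : ℕ} (d : ℕ) (What : Matrix (Fin n) (Fin n) ℝ) : Stacked n d →ₗ[ℝ] Stacked n d where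
  toFun x := WithLp.toLp 2 fun i => ∑ j, What i j • x j
  map_add' x y := by
    ext i a
    simp [smul_add, Finset.sum_add_distrib]
  map_smul' c x := by
    ext i a
    simp [Finset.mul_sum, mul_left_comm]

/-- The largest eigenvalue of `W`. -/
def lamMax {n : ℕ} (d : ℕ) (What : Matrix (Fin n) (Fin n) ℝ) : ℝ :=
  sSup {r : ℝ | Module.End.HasEigenvalue (commOp d What) r}

/-- The smallest positive eigenvalue of `W`. -/
def lamMinPos {n : ℕ} (d : ℕ) (What : Matrix (Fin n) (Fin n) ℝ) : ℝ :=
  sInf {r : ℝ | 0 < r ∧ Module.End.HasEigenvalue (commOp d What) r}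

/-! ### The penalized problem -/

/-- `φ` is (differentiable and) `L`-smooth and `μ`-strongly convex. -/
structure SmoothStrong {d : ℕ} (L μ : ℝ) (φ : EuclideanSpace ℝ (Fin d) → ℝ) : Prop where
  diff : Differentiable ℝ φ
  smooth : ∀ x y, ‖∇ φ y - ∇ φ x‖ ≤ L * ‖y - x‖
  strong : ∀ x y, ⟪∇ φ x, y - x⟫ + μ / 2 * ‖y - x‖ ^ 2 ≤ φ y - φ x

/-- `(1/n) ∑ f_k(x_k)`. -/
def loss {n d : ℕ} (f : Fin n → EuclideanSpace ℝ (Fin d) → ℝ) (x : Stacked n d) : ℝ :=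
  1 / (n : ℝ) * ∑ k, f k (x k)

/-- `(lam/2) ⟨x, W x⟩`. -/
def penalty {n d : ℕ} (lam : ℝ) (What : Matrix (Fin n) (Fin n) ℝ) (x : Stacked n d) : ℝ :=
  lam / 2 * ⟪x, commOp d What x⟫

/-- The penalized objective `F`. -/
def objective {n d : ℕ} (f : Fin n → EuclideanSpace ℝ (Fin d) → ℝ) (lam : ℝ)
    (What : Matrix (Fin n) (Fin n) ℝ) (x : Stacked n d) : ℝ :=
  loss f x + penalty lam What x

/-! ### The Accelerated Meta-Algorithm of order `p = 1` and its restarts, with inexact steps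

These predicates describe what a run of the method is for a composite objective `φ + ψ`,
whatever procedure is used for the auxiliary problems. -/

section Meta

variable {E : Type} [NormedAddCommGroup E] [InnerProductSpace ℝ E] [CompleteSpace E]

/-- The objective `Ω_1(φ, w; y) + ψ(y) + (H/2) ‖y - w‖²` of the auxiliary problem. -/
def auxObjective (φ ψ : E → ℝ) (H : ℝ) (w y : E) : ℝ :=
  φ w + ⟪∇ φ w, y - w⟫ + ψ y + H / 2 * ‖y - w‖ ^ 2

/-- `y` solves the auxiliary problem at `w` with accuracy `δ`: its squared distance to a
minimizer is at most `δ`. -/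
def SolvesAux (φ ψ : E → ℝ) (H δ : ℝ) (w y : E) : Prop :=
  ∃ yStar : E, (∀ u, auxObjective φ ψ H w yStar ≤ auxObjective φ ψ H w u) ∧
    ‖y - yStar‖ ^ 2 ≤ δ

/-- `out` is the output of `N` iterations of the Accelerated Meta-Algorithm (`p = 1`) from `z₀`,
with auxiliary problems solved with accuracy `δ`. For `p = 1` the two bounds on the parameter `η`
are `1/2 ≤ η H` and `η H ≤ p / (p + 1) = 1/2`. -/
def IsAMRun (φ ψ : E → ℝ) (H δ : ℝ) (N : ℕ) (z₀ out : E) : Prop :=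
  ∃ (y z w : ℕ → E) (A a η : ℕ → ℝ),
    A 0 = 0 ∧ y 0 = z₀ ∧ z 0 = z₀ ∧
    (∀ k < N,
      1 / 2 ≤ η (k + 1) * H ∧ η (k + 1) * H ≤ 1 / 2 ∧
      a (k + 1) = (η (k + 1) + √(η (k + 1) ^ 2 + 4 * η (k + 1) * A k)) / 2 ∧
      A (k + 1) = A k + a (k + 1) ∧
      w k = (A k / A (k + 1)) • y k + (a (k + 1) / A (k + 1)) • z k ∧
      SolvesAux φ ψ H δ (w k) (y (k + 1)) ∧
      z (k + 1) = z k - a (k + 1) • ∇ φ (y (k + 1)) - a (k + 1) • ∇ ψ (y (k + 1))) ∧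
    out = y N

/-- `out` is the output of the Restarted Accelerated Meta-Algorithm with `s` restarts of `N`
iterations each, started at `z₀`. -/
def IsRAMRun (φ ψ : E → ℝ) (H δ : ℝ) (N s : ℕ) (z₀ out : E) : Prop :=
  ∃ ζ : ℕ → E, ζ 0 = z₀ ∧ (∀ k < s, IsAMRun φ ψ H δ N (ζ k) (ζ (k + 1))) ∧ out = ζ s

/-- The number of iterations between two restarts,
`max {⌈(p+1) (8 H 2^(p-1) R_k^(p-1) / (μF p!))^(2/(3p+1))⌉, 1}` at `p = 1`. -/
def restartLength (H μF : ℝ) : ℕ := max ⌈2 * √(8 * H / μF)⌉₊ 1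

end Meta

/-! ### Oracle programs: access to the `f_k` and to `W` only through counted calls -/

/-- A program that, besides free local computation on vectors of `E`, can ask for one
communication round (multiplication of a vector by `W`) or for one local gradient call at every
node (the stacked vector of the `∇ f_k(x_k)`), and that returns an element of `α`. -/
inductive Prog (E α : Type) : Type
  | ret (a : α) : Prog E α
  | comm (x : E) (cont : E → Prog E α) : Prog E α
  | grad (x : E) (cont : E → Prog E α) : Prog E α

/-- The result of a program with the number of communications and of local gradient calls. -/
structure Outcome (α : Type) : Type where
  val : α
  comms : ℕ
  grads : ℕ

section Programs

variable {E α β : Type}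

/-- Sequential composition. -/
def Prog.bind : Prog E α → (α → Prog E β) → Prog E β
  | .ret a, q => q a
  | .comm x cont, q => .comm x fun v => (cont v).bind q
  | .grad x cont, q => .grad x fun v => (cont v).bind q

/-- `steps` repetitions of `body`. -/
def Prog.repeatN (body : α → Prog E α) : ℕ → α → Prog E α
  | 0, st => .ret st
  | k + 1, st => (body st).bind (Prog.repeatN body k)

/-- Execution with the communication oracle `W` and the local gradient oracle `D`. -/
def Prog.run (W D : E → E) : Prog E α → Outcome α
  | .ret a => ⟨a, 0, 0⟩
  | .comm x cont =>
      let r := (cont (W x)).run W D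
      ⟨r.val, r.comms + 1, r.grads⟩
  | .grad x cont =>
      let r := (cont (D x)).run W D
      ⟨r.val, r.comms, r.grads + 1⟩

variable [NormedAddCommGroup E] [InnerProductSpace ℝ E]

/-- The gradient `lam • W x` of the penalty, by one communication. -/
def penaltyGrad (lam : ℝ) (x : E) : Prog E E := .comm x fun v => .ret (lam • v)

/-- The gradient of the loss, by one local gradient call at every node. -/
def lossGrad (n : ℕ) (x : E) : Prog E E := .grad x fun v => .ret ((1 / (n : ℝ)) • v)

/-- `T` steps of Nesterov's accelerated gradient method from `x₀`, for a function with gradient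
`DΦ`, smoothness constant `Li` and strong convexity constant `mi`. -/
def nesterov (DΦ : E → Prog E E) (Li mi : ℝ) (T : ℕ) (x₀ : E) : Prog E E :=
  (Prog.repeatN
    (fun st : E × E =>
      (DΦ st.2).bind fun v =>
        let x' := st.2 - (1 / Li) • v
        .ret (x', x' + ((√Li - √mi) / (√Li + √mi)) • (x' - st.1)))
    T (x₀, x₀)).bind fun st => .ret st.1

/-- The current `y`, `z` and `A` of the Accelerated Meta-Algorithm. -/
structure AMState (E : Type) : Type where
  y : E
  z : E
  A : ℝ

/-- One iteration of the Accelerated Meta-Algorithm (`p = 1`) for `φ + ψ`, given programs for the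
two gradients; the auxiliary problem is treated by `T` steps of Nesterov's method, started at
`w - ∇φ(w)/H`. -/
def amStep (Dφ Dψ : E → Prog E E) (H Li mi : ℝ) (T : ℕ) (st : AMState E) : Prog E (AMState E) :=
  let η : ℝ := 1 / (2 * H)
  let a := (η + √(η ^ 2 + 4 * η * st.A)) / 2
  let A' := st.A + a
  let w := (st.A / A') • st.y + (a / A') • st.z
  (Dφ w).bind fun gw =>
    (nesterov (fun y => (Dψ y).bind fun v => .ret (gw + v + H • (y - w))) Li mi T
        (w - (1 / H) • gw)).bind fun y' =>
      (Dφ y').bind fun gφ =>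
        (Dψ y').bind fun gψ =>
          .ret ⟨y', st.z - a • gφ - a • gψ, A'⟩

/-- The Accelerated Meta-Algorithm: `N` iterations from `z₀`. -/
def amProg (Dφ Dψ : E → Prog E E) (H Li mi : ℝ) (T N : ℕ) (z₀ : E) : Prog E E :=
  (Prog.repeatN (amStep Dφ Dψ H Li mi T) N ⟨z₀, z₀, 0⟩).bind fun st => .ret st.y

/-- The Restarted Accelerated Meta-Algorithm: `s` restarts of `N` iterations. -/
def ramProg (Dφ Dψ : E → Prog E E) (H Li mi : ℝ) (T N s : ℕ) (z₀ : E) : Prog E E :=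
  Prog.repeatN (amProg Dφ Dψ H Li mi T N) s z₀

end Programs

/-! ### Application to the penalized problem

`Lf` and `μf` are the constants of smoothness and strong convexity of the loss, `Lp` and `μp` the
largest and the smallest positive eigenvalue of the Hessian `lam • W` of the penalty. The part of
`F` with the smaller smoothness constant is linearized (it plays the role of `φ`), the other one
is kept in the auxiliary problem (`ψ`). -/

/-- The linearized part of the objective. -/
def linearizedPart {n d : ℕ} (f : Fin n → EuclideanSpace ℝ (Fin d) → ℝ) (lam : ℝ)
    (What : Matrix (Fin n) (Fin n) ℝ) (Lf Lp : ℝ) : Stacked n d → ℝ :=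
  if Lf ≤ Lp then loss f else penalty lam What

/-- The part of the objective that is kept in the auxiliary problem. -/
def compositePart {n d : ℕ} (f : Fin n → EuclideanSpace ℝ (Fin d) → ℝ) (lam : ℝ)
    (What : Matrix (Fin n) (Fin n) ℝ) (Lf Lp : ℝ) : Stacked n d → ℝ :=
  if Lf ≤ Lp then penalty lam What else loss f

/-- The parameter `H = (p + 1) L_p(φ)` at `p = 1`. -/
def paramH (Lf Lp : ℝ) : ℝ := 2 * min Lf Lp

/-- The whole method for the penalized problem, as an oracle program. -/
def method (n d : ℕ) (lam Lf μf Lp μp : ℝ) (T s : ℕ) (z₀ : Stacked n d) :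
    Prog (Stacked n d) (Stacked n d) :=
  let H := paramH Lf Lp
  let N := restartLength H μf
  if Lf ≤ Lp then
    ramProg (lossGrad n) (penaltyGrad lam) H (H + Lp) (H + μp) T N s z₀
  else
    ramProg (penaltyGrad lam) (lossGrad n) H (H + Lf) (H + μf) T N s z₀

/-- The execution of the method, with `W` and the gradients of the `f_k` as oracles. -/
def execute {n d : ℕ} (f : Fin n → EuclideanSpace ℝ (Fin d) → ℝ)
    (What : Matrix (Fin n) (Fin n) ℝ) (lam Lf μf Lp μp : ℝ) (T s : ℕ) (z₀ : Stacked n d) :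
    Outcome (Stacked n d) :=
  (method n d lam Lf μf Lp μp T s z₀).run (commOp d What)
    (fun x => WithLp.toLp 2 fun k => ∇ (f k) (x k))

/-- The accuracy `ε μF / (864² (L(f) + L(g) + H)²)` for the auxiliary problems. -/
def auxAccuracy (ε μF Lf Lp H : ℝ) : ℝ := ε * μF / (864 ^ 2 * (Lf + Lp + H) ^ 2)

end

end PFL

open PFL

/-! Outer loop. If ρ = (Lψ + H)√δ bounds the gradient residual of the auxiliary solves, the
potential A_k (F(y_k) - F(x*)) + ‖z_k - x*‖²/2 grows by at most (8/7) η ρ² A_{k+1} per iteration,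
while A_N ≥ N²/(8H). The choice of N turns this into F - F(x*) ≤ (μ_f/8) R² + ε/8 after a stage
started at distance R from x*. Strong convexity then divides the squared distance by four, up to
ε/(4μ_f), so that a number of restarts of order log(‖z₀ - x*‖²/ε) suffices
(`CompositeProblem.restarted_gap_le`).

Inner loop. Nesterov's method converges linearly, but the penalty is strongly convex only along the
range of W. The starting point w - ∇φ(w)/H minimizes the auxiliary objective without ψ; therefore
all iterates and the auxiliary minimizer lie in one translate of that range, where the condition
number is (H + L_p)/(H + λλ⁺_min) ≤ χ (`nesterovIter_dist_sq_le`,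
`CompositeProblem.innerSolver_solvesAux`). This produces √(Lχ/μ) in the minimum.

T is fixed in advance, so the initial error of every inner run needs an a priori bound. A crude
recursion bounds all points of a stage in terms of N, which does not depend on ε. The bound enters T
only through a logarithm, and log(1/δ) dominates it for ε ≤ ε₀ (`CompositeProblem.exists_schedule`).

Counting. The oracle of ψ is called sN(T + 1) times, that of φ 2sN times. Whichever part is
linearized, √(min{L_f, L_p}/μ_f) times the root of the inner condition number is at most 2√(max{L_f,
L_p}/μ_f) (`sqrt_condition_mul_le`). -/

namespace PFL

/-! ### Values and oracle counts of the programs -/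

section Programs

variable {E α β : Type}

theorem Prog.run_bind (W D : E → E) (p : Prog E α) (q : α → Prog E β) :
    (p.bind q).run W D =
      ⟨((q (p.run W D).val).run W D).val,
        (p.run W D).comms + ((q (p.run W D).val).run W D).comms,
        (p.run W D).grads + ((q (p.run W D).val).run W D).grads⟩ := by
  induction p with
  | ret a => simp [Prog.bind, Prog.run]
  | comm x cont ih => simp [Prog.bind, Prog.run, ih]; omega
  | grad x cont ih => simp [Prog.bind, Prog.run, ih]; omega

theorem Prog.run_repeatN_val (W D : E → E) (body : α → Prog E α) (k : ℕ) (st : α) :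
    ((Prog.repeatN body k st).run W D).val = (fun a => ((body a).run W D).val)^[k] st := by
  induction k generalizing st with
  | zero => rfl
  | succ k ih => simp [Prog.repeatN, Prog.run_bind, ih]

theorem Prog.run_repeatN_comms (W D : E → E) (body : α → Prog E α) (c : ℕ)
    (h : ∀ a, ((body a).run W D).comms = c) (k : ℕ) (st : α) :
    ((Prog.repeatN body k st).run W D).comms = k * c := by
  induction k generalizing st with
  | zero => simp [Prog.repeatN, Prog.run]
  | succ k ih => simp [Prog.repeatN, Prog.run_bind, ih, h]; ring

theorem Prog.run_repeatN_grads (W D : E → E) (body : α → Prog E α) (c : ℕ)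
    (h : ∀ a, ((body a).run W D).grads = c) (k : ℕ) (st : α) :
    ((Prog.repeatN body k st).run W D).grads = k * c := by
  induction k generalizing st with
  | zero => simp [Prog.repeatN, Prog.run]
  | succ k ih => simp [Prog.repeatN, Prog.run_bind, ih, h]; ring

variable [NormedAddCommGroup E] [InnerProductSpace ℝ E]

/-- One step of Nesterov's method with constant momentum on the pair (iterate, extrapolation). -/
noncomputable def nesterovStep (G : E → E) (Li mi : ℝ) (st : E × E) : E × E :=
  (st.2 - (1 / Li) • G st.2,
    (st.2 - (1 / Li) • G st.2) +
      ((√Li - √mi) / (√Li + √mi)) • ((st.2 - (1 / Li) • G st.2) - st.1))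

/-- The result of `T` steps of Nesterov's method started at `x₀`. -/
noncomputable def nesterovIter (G : E → E) (Li mi : ℝ) (T : ℕ) (x₀ : E) : E :=
  ((nesterovStep G Li mi)^[T] (x₀, x₀)).1

/-- A program computes the map `g` with `c` communications and `l` gradient calls. -/
structure Computes (W D : E → E) (p : E → Prog E E) (g : E → E) (c l : ℕ) : Prop where
  val : ∀ x, ((p x).run W D).val = g x
  comms : ∀ x, ((p x).run W D).comms = c
  grads : ∀ x, ((p x).run W D).grads = l

theorem Computes.nesterov {W D : E → E} {DΦ : E → Prog E E} {G : E → E} {c l : ℕ}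
    (h : Computes W D DΦ G c l) (Li mi : ℝ) (T : ℕ) :
    Computes W D (nesterov DΦ Li mi T) (nesterovIter G Li mi T) (T * c) (T * l) where
  val x := by
    simp only [PFL.nesterov, Prog.run_bind, Prog.run_repeatN_val, h.val, Prog.run]
    rfl
  comms x := by
    simp only [PFL.nesterov, Prog.run_bind, Prog.run, add_zero]
    exact Prog.run_repeatN_comms W D _ c
      (fun a => by simp [Prog.run_bind, Prog.run, h.comms]) T _
  grads x := by
    simp only [PFL.nesterov, Prog.run_bind, Prog.run, add_zero]
    exact Prog.run_repeatN_grads W D _ l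
      (fun a => by simp [Prog.run_bind, Prog.run, h.grads]) T _

/-- The next value of the step parameter `a` of the Accelerated Meta-Algorithm. -/
noncomputable def nextWeight (H A : ℝ) : ℝ :=
  (1 / (2 * H) + √((1 / (2 * H)) ^ 2 + 4 * (1 / (2 * H)) * A)) / 2

/-- The point at which an iteration of the Accelerated Meta-Algorithm linearizes. -/
noncomputable def AMState.query (H : ℝ) (st : AMState E) : E :=
  (st.A / (st.A + nextWeight H st.A)) • st.y +
    (nextWeight H st.A / (st.A + nextWeight H st.A)) • st.z

/-- One iteration of the Accelerated Meta-Algorithm with gradient maps `gφ`, `gψ`, whose auxiliary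
problems are treated by `S`. -/
noncomputable def amUpdate (gφ gψ : E → E) (H : ℝ) (S : E → E) (st : AMState E) : AMState E :=
  ⟨S (st.query H),
    st.z - nextWeight H st.A • gφ (S (st.query H)) - nextWeight H st.A • gψ (S (st.query H)),
    st.A + nextWeight H st.A⟩

/-- `T` steps of Nesterov's method for the auxiliary problem at `w`. -/
noncomputable def innerSolver (gφ gψ : E → E) (H Li mi : ℝ) (T : ℕ) (w : E) : E :=
  nesterovIter (fun y => gφ w + gψ y + H • (y - w)) Li mi T (w - (1 / H) • gφ w)

variable {W D : E → E} {Dφ Dψ : E → Prog E E} {gφ gψ : E → E} {cφ lφ cψ lψ : ℕ}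

theorem Computes.auxGradient (hψ : Computes W D Dψ gψ cψ lψ) (H : ℝ) (g w : E) :
    Computes W D (fun y => (Dψ y).bind fun v => .ret (g + v + H • (y - w)))
      (fun y => g + gψ y + H • (y - w)) cψ lψ where
  val x := by simp [Prog.run_bind, Prog.run, hψ.val]
  comms x := by simp [Prog.run_bind, Prog.run, hψ.comms]
  grads x := by simp [Prog.run_bind, Prog.run, hψ.grads]

theorem Computes.amStep_val (hφ : Computes W D Dφ gφ cφ lφ) (hψ : Computes W D Dψ gψ cψ lψ)
    (H Li mi : ℝ) (T : ℕ) (st : AMState E) :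
    ((amStep Dφ Dψ H Li mi T st).run W D).val =
      amUpdate gφ gψ H (innerSolver gφ gψ H Li mi T) st := by
  have hn := fun g w => ((hψ.auxGradient H g w).nesterov Li mi T).val
  simp only [amStep, Prog.run_bind, hn, hφ.val, hψ.val, Prog.run]
  rfl

theorem Computes.amStep_comms (hφ : Computes W D Dφ gφ cφ lφ) (hψ : Computes W D Dψ gψ cψ lψ)
    (H Li mi : ℝ) (T : ℕ) (st : AMState E) :
    ((amStep Dφ Dψ H Li mi T st).run W D).comms = 2 * cφ + (T + 1) * cψ := by
  have hn := fun g w => ((hψ.auxGradient H g w).nesterov Li mi T).comms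
  simp only [amStep, Prog.run_bind, hn, hφ.comms, hψ.comms, Prog.run]
  ring

theorem Computes.amStep_grads (hφ : Computes W D Dφ gφ cφ lφ) (hψ : Computes W D Dψ gψ cψ lψ)
    (H Li mi : ℝ) (T : ℕ) (st : AMState E) :
    ((amStep Dφ Dψ H Li mi T st).run W D).grads = 2 * lφ + (T + 1) * lψ := by
  have hn := fun g w => ((hψ.auxGradient H g w).nesterov Li mi T).grads
  simp only [amStep, Prog.run_bind, hn, hφ.grads, hψ.grads, Prog.run]
  ring

/-- The output of `N` iterations of the Accelerated Meta-Algorithm. -/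
noncomputable def amIter (gφ gψ : E → E) (H : ℝ) (S : E → E) (N : ℕ) (z₀ : E) : E :=
  ((amUpdate gφ gψ H S)^[N] ⟨z₀, z₀, 0⟩).y

theorem Computes.amProg (hφ : Computes W D Dφ gφ cφ lφ) (hψ : Computes W D Dψ gψ cψ lψ)
    (H Li mi : ℝ) (T N : ℕ) :
    Computes W D (amProg Dφ Dψ H Li mi T N)
      (amIter gφ gψ H (innerSolver gφ gψ H Li mi T) N)
      (N * (2 * cφ + (T + 1) * cψ)) (N * (2 * lφ + (T + 1) * lψ)) where
  val x := by
    simp only [PFL.amProg, Prog.run_bind, Prog.run_repeatN_val, hφ.amStep_val hψ, Prog.run]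
    rfl
  comms x := by
    simp only [PFL.amProg, Prog.run_bind, Prog.run, add_zero]
    exact Prog.run_repeatN_comms W D _ _ (hφ.amStep_comms hψ H Li mi T) N _
  grads x := by
    simp only [PFL.amProg, Prog.run_bind, Prog.run, add_zero]
    exact Prog.run_repeatN_grads W D _ _ (hφ.amStep_grads hψ H Li mi T) N _

theorem Computes.ramProg (hφ : Computes W D Dφ gφ cφ lφ) (hψ : Computes W D Dψ gψ cψ lψ)
    (H Li mi : ℝ) (T N s : ℕ) :
    Computes W D (ramProg Dφ Dψ H Li mi T N s)
      (amIter gφ gψ H (innerSolver gφ gψ H Li mi T) N)^[s]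
      (s * (N * (2 * cφ + (T + 1) * cψ))) (s * (N * (2 * lφ + (T + 1) * lψ))) where
  val x := by
    simp only [PFL.ramProg, Prog.run_repeatN_val, (hφ.amProg hψ H Li mi T N).val]
  comms x := Prog.run_repeatN_comms W D _ _ (hφ.amProg hψ H Li mi T N).comms s _
  grads x := Prog.run_repeatN_grads W D _ _ (hφ.amProg hψ H Li mi T N).grads s _

end Programs

/-! ### Nesterov's method under strong convexity along a subspace -/

section Nesterov

variable {E : Type} [NormedAddCommGroup E] [InnerProductSpace ℝ E]

/-- The quadratic upper bound of a function with Lipschitz gradient. -/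
theorem le_quadratic_of_lipschitz_gradient {φ : E → ℝ} {G : E → E} {L : ℝ}
    (hd : ∀ x, HasFDerivAt φ (innerSL ℝ (G x)) x) (hL : ∀ x y, ‖G y - G x‖ ≤ L * ‖y - x‖)
    (x y : E) : φ y ≤ φ x + ⟪G x, y - x⟫ + L / 2 * ‖y - x‖ ^ 2 := by
  set h := y - x with hh
  set c := ⟪G x, h⟫ with hc
  -- The defect of the quadratic bound along the segment from `x` to `y`; the Lipschitz condition
  -- makes its derivative nonpositive on [0, 1].
  let q : ℝ → ℝ := fun t => φ (x + t • h) - t * c - L / 2 * ‖h‖ ^ 2 * t ^ 2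
  have hq : ∀ t, HasDerivAt q (⟪G (x + t • h), h⟫ - c - L * ‖h‖ ^ 2 * t) t := by
    intro t
    have h1 : HasDerivAt (fun t : ℝ => x + t • h) h t := by
      simpa using ((hasDerivAt_id t).smul_const h).const_add x
    have h2 := (hd (x + t • h)).comp_hasDerivAt t h1
    have h3 : HasDerivAt (fun t : ℝ => t * c) c t := by
      simpa using (hasDerivAt_id t).mul_const c
    have h4 : HasDerivAt (fun t : ℝ => L / 2 * ‖h‖ ^ 2 * t ^ 2) (L * ‖h‖ ^ 2 * t) t := by
      have := (hasDerivAt_pow 2 t).const_mul (L / 2 * ‖h‖ ^ 2)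
      refine this.congr_deriv ?_
      norm_num; ring
    exact (h2.sub h3).sub h4
  have hanti : AntitoneOn q (Set.Icc 0 1) := by
    apply antitoneOn_of_deriv_nonpos (convex_Icc 0 1)
    · exact fun t _ => (hq t).continuousAt.continuousWithinAt
    · exact fun t _ => (hq t).differentiableAt.differentiableWithinAt
    · intro t ht
      rw [interior_Icc] at ht
      rw [(hq t).deriv]
      have h1 : ⟪G (x + t • h) - G x, h⟫ ≤ L * (t * ‖h‖) * ‖h‖ := by
        refine (real_inner_le_norm _ _).trans ?_
        gcongr
        simpa [norm_smul, abs_of_pos ht.1] using hL x (x + t • h)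
      rw [inner_sub_left] at h1
      nlinarith
  have := hanti (Set.left_mem_Icc.2 zero_le_one) (Set.right_mem_Icc.2 zero_le_one) zero_le_one
  simp only [q, one_smul, zero_smul, add_zero] at this
  rw [hh, add_sub_cancel] at this
  nlinarith

/-- Add convexity between `v` and `x` with weight 1 - γ, strong convexity between `v` and `xs` with
weight γ, and the descent inequality. Expanding the square cancels all terms in `g`, and the slack
is (m/2) γ (1 - γ) ‖u - v‖². -/
theorem nesterov_potential_decrease {Φx Φv Φs Φx' m γ : ℝ} {x v u xs g : E} (hm : 0 < m)
    (hγ0 : 0 ≤ γ) (hγ1 : γ ≤ 1) (hxv : x - v = γ • (v - u))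
    (h1 : ⟪g, x - v⟫ ≤ Φx - Φv) (h2 : ⟪g, xs - v⟫ + m / 2 * ‖xs - v‖ ^ 2 ≤ Φs - Φv)
    (h3 : Φx' ≤ Φv - γ ^ 2 / (2 * m) * ‖g‖ ^ 2) :
    Φx' - Φs + m / 2 * ‖(1 - γ) • u + γ • v - (γ / m) • g - xs‖ ^ 2 ≤
      (1 - γ) * (Φx - Φs + m / 2 * ‖u - xs‖ ^ 2) := by
  obtain ⟨p, rfl⟩ : ∃ p, u = xs + p := ⟨u - xs, by abel⟩
  obtain ⟨q, rfl⟩ : ∃ q, v = xs + q := ⟨v - xs, by abel⟩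
  have e1 : (1 - γ) • (xs + p) + γ • (xs + q) - (γ / m) • g - xs =
      ((1 - γ) • p + γ • q) - (γ / m) • g := by module
  have e2 : xs + q - (xs + p) = q - p := by abel
  have e3 : xs - (xs + q) = -q := by abel
  have e4 : ‖((1 - γ) • p + γ • q) - (γ / m) • g‖ ^ 2 =
      (1 - γ) ^ 2 * ‖p‖ ^ 2 + 2 * (1 - γ) * γ * ⟪p, q⟫ + γ ^ 2 * ‖q‖ ^ 2
        - 2 * (γ / m) * ((1 - γ) * ⟪g, p⟫ + γ * ⟪g, q⟫) + (γ / m) ^ 2 * ‖g‖ ^ 2 := by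
    rw [norm_sub_sq_real, norm_add_sq_real]
    simp only [norm_smul, mul_pow, inner_add_right, inner_smul_left, inner_smul_right,
      Real.norm_eq_abs, sq_abs, RCLike.conj_to_real, real_inner_comm g]
    ring
  have e5 : 0 ≤ ‖p‖ ^ 2 - 2 * ⟪p, q⟫ + ‖q‖ ^ 2 := by
    rw [← norm_sub_sq_real]; positivity
  rw [hxv, e2, inner_smul_right, inner_sub_right] at h1
  rw [e3, inner_neg_right, norm_neg] at h2
  rw [e1, e4, add_sub_cancel_left]
  have e6 : 0 ≤ m / 2 * (γ * (1 - γ)) * (‖p‖ ^ 2 - 2 * ⟪p, q⟫ + ‖q‖ ^ 2) :=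
    mul_nonneg (mul_nonneg (by positivity) (mul_nonneg hγ0 (by linarith))) e5
  have f1 := mul_le_mul_of_nonneg_left h1 (sub_nonneg.2 hγ1)
  have f2 := mul_le_mul_of_nonneg_left h2 hγ0
  have k1 : m / 2 * (2 * (γ / m) * ((1 - γ) * ⟪g, p⟫ + γ * ⟪g, q⟫)) =
      γ * ((1 - γ) * ⟪g, p⟫ + γ * ⟪g, q⟫) := by field_simp
  have k2 : m / 2 * ((γ / m) ^ 2 * ‖g‖ ^ 2) = γ ^ 2 / (2 * m) * ‖g‖ ^ 2 := by field_simp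
  linear_combination f1 + f2 + h3 + e6 - k1 + k2

/-- Linear convergence of Nesterov's method with constant momentum, for a function that is only
assumed to be strongly convex along an affine subspace `x₀ + K` that the iterates do not leave. -/
theorem nesterovIter_dist_sq_le {Φ : E → ℝ} {G : E → E} {K : Submodule ℝ E} {Li mi : ℝ}
    {x₀ xs : E} (hmi : 0 < mi) (hle : mi ≤ Li)
    (hG : ∀ v, v - x₀ ∈ K → G v ∈ K)
    (hstrong : ∀ u v, u - x₀ ∈ K → v - x₀ ∈ K →
      ⟪G v, u - v⟫ + mi / 2 * ‖u - v‖ ^ 2 ≤ Φ u - Φ v)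
    (hdesc : ∀ v, Φ (v - (1 / Li) • G v) ≤ Φ v - 1 / (2 * Li) * ‖G v‖ ^ 2)
    (hxs : xs - x₀ ∈ K) (hGs : G xs = 0) (hlip : ‖G x₀‖ ≤ Li * ‖x₀ - xs‖) (T : ℕ) :
    ‖nesterovIter G Li mi T x₀ - xs‖ ^ 2 ≤
      4 * (Li / mi) * Real.exp (-(√(mi / Li) * T)) * ‖x₀ - xs‖ ^ 2 := by
  have hLi : 0 < Li := hmi.trans_le hle
  set γ := √(mi / Li) with hγ
  have hγ0 : 0 < γ := Real.sqrt_pos.2 (by positivity)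
  have hγ1 : γ ≤ 1 := Real.sqrt_le_one.2 ((div_le_one hLi).2 hle)
  have hγsq : γ ^ 2 = mi / Li := Real.sq_sqrt (by positivity)
  have hβ : (√Li - √mi) / (√Li + √mi) = (1 - γ) / (1 + γ) := by
    have : 0 < √Li := Real.sqrt_pos.2 hLi
    have : 0 < √mi := Real.sqrt_pos.2 hmi
    rw [hγ, Real.sqrt_div hmi.le]
    field_simp
  have hcoef : γ / mi = 1 / (γ * Li) := by
    rw [div_eq_div_iff hmi.ne' (by positivity)]
    rw [eq_div_iff hLi.ne'] at hγsq
    linarith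
  have hx₀ : x₀ - x₀ ∈ K := by simp
  have hmin : ∀ x, x - x₀ ∈ K → mi / 2 * ‖x - xs‖ ^ 2 ≤ Φ x - Φ xs := by
    intro x hx
    simpa [hGs] using hstrong x xs hx hxs
  -- The method keeps two sequences; the point `u` of the three-sequence form is recovered from x -
  -- v = γ(v - u). As `v` is a convex combination of `x` and `u`, it stays in x₀ + K with them.
  have key : ∀ T : ℕ, ((nesterovStep G Li mi)^[T] (x₀, x₀)).1 - x₀ ∈ K ∧
      ∃ u : E, u - x₀ ∈ K ∧
        ((nesterovStep G Li mi)^[T] (x₀, x₀)).1 - ((nesterovStep G Li mi)^[T] (x₀, x₀)).2 =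
          γ • (((nesterovStep G Li mi)^[T] (x₀, x₀)).2 - u) ∧
        Φ ((nesterovStep G Li mi)^[T] (x₀, x₀)).1 - Φ xs + mi / 2 * ‖u - xs‖ ^ 2 ≤
          (1 - γ) ^ T * (Φ x₀ - Φ xs + mi / 2 * ‖x₀ - xs‖ ^ 2) := by
    intro T
    induction T with
    | zero => exact ⟨by simp, x₀, by simp, by simp, by simp⟩
    | succ T ih =>
      rw [Function.iterate_succ_apply']
      obtain ⟨hx, u, hu, huv, hV⟩ := ih
      generalize (nesterovStep G Li mi)^[T] (x₀, x₀) = st at hx huv hV ⊢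
      obtain ⟨x, v⟩ := st
      simp only [nesterovStep] at hx huv hV ⊢
      have hv : v - x₀ ∈ K := by
        have : v - x₀ = (1 / (1 + γ)) • ((x - x₀) + γ • (u - x₀)) := by
          have h1 : (1 + γ) • (v - x₀) = (x - x₀) + γ • (u - x₀) := by
            have : x = v + γ • (v - u) := by rw [← huv]; abel
            rw [this]; module
          rw [← h1, smul_smul, one_div_mul_cancel (by positivity), one_smul]
        rw [this]
        exact K.smul_mem _ (K.add_mem hx (K.smul_mem _ hu))
      have hu' : (1 - γ) • u + γ • v - (γ / mi) • G v - x₀ ∈ K := by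
        have : (1 - γ) • u + γ • v - (γ / mi) • G v - x₀ =
            (1 - γ) • (u - x₀) + γ • (v - x₀) - (γ / mi) • G v := by module
        rw [this]
        exact K.sub_mem (K.add_mem (K.smul_mem _ hu) (K.smul_mem _ hv)) (K.smul_mem _ (hG v hv))
      refine ⟨?_, (1 - γ) • u + γ • v - (γ / mi) • G v, hu', ?_, ?_⟩
      · have : v - (1 / Li) • G v - x₀ = (v - x₀) - (1 / Li) • G v := by abel
        rw [this]
        exact K.sub_mem hv (K.smul_mem _ (hG v hv))
      · have hxe : x = v + γ • (v - u) := by rw [← huv]; abel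
        rw [hβ, hcoef, hxe]
        have h1 : (1 : ℝ) + γ ≠ 0 := by positivity
        match_scalars <;> field_simp <;> ring
      · have hdec := nesterov_potential_decrease (Φx := Φ x) (Φv := Φ v) (Φs := Φ xs)
          (Φx' := Φ (v - (1 / Li) • G v)) (u := u) (xs := xs) (g := G v) hmi hγ0.le hγ1 huv
          (by nlinarith [hstrong x v hx hv, sq_nonneg ‖x - v‖]) (hstrong xs v hxs hv)
          (by
            have : γ ^ 2 / (2 * mi) = 1 / (2 * Li) := by rw [hγsq]; field_simp
            rw [this]; exact hdesc v)
        refine hdec.trans ?_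
        rw [pow_succ' (1 - γ), mul_assoc]
        exact mul_le_mul_of_nonneg_left hV (by linarith)
  obtain ⟨hxT, u, -, -, hV⟩ := key T
  change ((nesterovStep G Li mi)^[T] (x₀, x₀)).1 - x₀ ∈ K at hxT
  have h0 : Φ x₀ - Φ xs + mi / 2 * ‖x₀ - xs‖ ^ 2 ≤ 2 * Li * ‖x₀ - xs‖ ^ 2 := by
    have h1 := hstrong xs x₀ hxs hx₀
    have h2 : ⟪G x₀, x₀ - xs⟫ ≤ Li * ‖x₀ - xs‖ * ‖x₀ - xs‖ :=
      (real_inner_le_norm _ _).trans (by gcongr)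
    rw [← neg_sub x₀ xs, inner_neg_right, norm_neg] at h1
    nlinarith [sq_nonneg ‖x₀ - xs‖]
  have hpow : (1 - γ) ^ T ≤ Real.exp (-(γ * T)) := by
    have h1 : 1 - γ ≤ Real.exp (-γ) := by linarith [Real.add_one_le_exp (-γ)]
    calc (1 - γ) ^ T ≤ Real.exp (-γ) ^ T := pow_le_pow_left₀ (by linarith) h1 T
      _ = Real.exp (-(γ * T)) := by rw [← Real.exp_nat_mul]; ring_nf
  have h2 : mi / 2 * ‖nesterovIter G Li mi T x₀ - xs‖ ^ 2 ≤
      Real.exp (-(γ * T)) * (2 * Li * ‖x₀ - xs‖ ^ 2) := by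
    calc mi / 2 * ‖nesterovIter G Li mi T x₀ - xs‖ ^ 2
        ≤ Φ (nesterovIter G Li mi T x₀) - Φ xs := hmin _ hxT
      _ ≤ (1 - γ) ^ T * (Φ x₀ - Φ xs + mi / 2 * ‖x₀ - xs‖ ^ 2) := by
          have : 0 ≤ mi / 2 * ‖u - xs‖ ^ 2 := by positivity
          change Φ ((nesterovStep G Li mi)^[T] (x₀, x₀)).1 - Φ xs ≤ _
          linarith
      _ ≤ (1 - γ) ^ T * (2 * Li * ‖x₀ - xs‖ ^ 2) :=
          mul_le_mul_of_nonneg_left h0 (pow_nonneg (by linarith) T)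
      _ ≤ _ := mul_le_mul_of_nonneg_right hpow (by positivity)
  calc ‖nesterovIter G Li mi T x₀ - xs‖ ^ 2
      = 2 / mi * (mi / 2 * ‖nesterovIter G Li mi T x₀ - xs‖ ^ 2) := by field_simp
    _ ≤ 2 / mi * (Real.exp (-(γ * T)) * (2 * Li * ‖x₀ - xs‖ ^ 2)) := by gcongr
    _ = _ := by ring

end Nesterov

/-! ### One stage of the inexact Accelerated Meta-Algorithm -/

section Composite

variable {E : Type} [NormedAddCommGroup E] [InnerProductSpace ℝ E] [CompleteSpace E]

/-- The assumptions on `φ + ψ` under which the Accelerated Meta-Algorithm is analysed: `φ` is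
`H/2`-smooth, `ψ` is convex and `Lψ`-smooth, the sum is `μ`-strongly convex, and `xs` is its
stationary point. -/
structure CompositeProblem (φ ψ : E → ℝ) (H Lψ μ : ℝ) (xs : E) : Prop where
  H_pos : 0 < H
  μ_pos : 0 < μ
  Lψ_nonneg : 0 ≤ Lψ
  diffφ : Differentiable ℝ φ
  lipφ : ∀ x y, ‖∇ φ y - ∇ φ x‖ ≤ H / 2 * ‖y - x‖
  diffψ : Differentiable ℝ ψ
  lipψ : ∀ x y, ‖∇ ψ y - ∇ ψ x‖ ≤ Lψ * ‖y - x‖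
  convψ : ∀ x y, ⟪∇ ψ x, y - x⟫ ≤ ψ y - ψ x
  strong : ∀ x y, ⟪∇ φ x + ∇ ψ x, y - x⟫ + μ / 2 * ‖y - x‖ ^ 2 ≤ φ y + ψ y - (φ x + ψ x)
  stationary : ∇ φ xs + ∇ ψ xs = 0

theorem hasFDerivAt_innerSL_gradient {φ : E → ℝ} (h : Differentiable ℝ φ) (x : E) :
    HasFDerivAt φ (innerSL ℝ (∇ φ x)) x :=
  (hasGradientAt_iff_hasFDerivAt.1 (h x).hasGradientAt)

theorem gradient_eq_zero_of_forall_le {φ : E → ℝ} {x : E} (h : ∀ y, φ x ≤ φ y) : ∇ φ x = 0 := by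
  have : IsLocalMin φ x := Filter.Eventually.of_forall h
  simp [gradient, this.fderiv_eq_zero]

theorem hasFDerivAt_auxObjective {φ ψ : E → ℝ} (h : Differentiable ℝ ψ) (H : ℝ) (w y : E) :
    HasFDerivAt (auxObjective φ ψ H w) (innerSL ℝ (∇ φ w + ∇ ψ y + H • (y - w))) y := by
  have h1 : HasFDerivAt (fun y : E => φ w + ⟪∇ φ w, y - w⟫) (innerSL ℝ (∇ φ w)) y :=
    (((innerSL ℝ (∇ φ w)).hasFDerivAt.comp y ((hasFDerivAt_id y).sub_const w))).const_add (φ w)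
  have h2 := hasFDerivAt_innerSL_gradient h y
  have h3 := ((((hasFDerivAt_id (𝕜 := ℝ) y).sub_const w)).norm_sq).const_mul (H / 2)
  refine ((h1.add h2).add h3).congr_fderiv ?_
  ext v
  simp
  ring

theorem gradient_auxObjective {φ ψ : E → ℝ} (h : Differentiable ℝ ψ) (H : ℝ) (w y : E) :
    ∇ (auxObjective φ ψ H w) y = ∇ φ w + ∇ ψ y + H • (y - w) :=
  HasGradientAt.gradient (hasGradientAt_iff_hasFDerivAt.2 (hasFDerivAt_auxObjective h H w y))

namespace CompositeProblem

variable {φ ψ : E → ℝ} {H Lψ μ δ ε : ℝ} {xs : E}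

theorem aux_stationary (P : CompositeProblem φ ψ H Lψ μ xs) {w y : E}
    (h : ∀ u, auxObjective φ ψ H w y ≤ auxObjective φ ψ H w u) :
    ∇ φ w + ∇ ψ y + H • (y - w) = 0 := by
  rw [← gradient_auxObjective P.diffψ]
  exact gradient_eq_zero_of_forall_le h

/-- The gradient of the auxiliary objective vanishes at its minimizer and is (Lψ + H)-Lipschitz.
This turns accuracy in distance into the residual that the potential argument uses. -/
theorem residual_le (P : CompositeProblem φ ψ H Lψ μ xs) {w y : E}
    (h : SolvesAux φ ψ H δ w y) :
    ‖∇ φ w + ∇ ψ y + H • (y - w)‖ ≤ (Lψ + H) * √δ := by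
  obtain ⟨ys, hmin, hd⟩ := h
  have h0 := P.aux_stationary hmin
  have e : ∇ φ w + ∇ ψ y + H • (y - w) = (∇ ψ y - ∇ ψ ys) + H • (y - ys) := by
    rw [← sub_zero (∇ φ w + ∇ ψ y + H • (y - w)), ← h0]; module
  have hd' : ‖y - ys‖ ≤ √δ := Real.le_sqrt_of_sq_le hd
  rw [e]
  calc _ ≤ ‖∇ ψ y - ∇ ψ ys‖ + ‖H • (y - ys)‖ := norm_add_le _ _
    _ ≤ Lψ * ‖y - ys‖ + H * ‖y - ys‖ := by
        gcongr
        · exact P.lipψ _ _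
        · rw [norm_smul, Real.norm_of_nonneg P.H_pos.le]
    _ = (Lψ + H) * ‖y - ys‖ := by ring
    _ ≤ _ := by
        have := P.Lψ_nonneg; have := P.H_pos
        gcongr

theorem dist_sq_le_gap (P : CompositeProblem φ ψ H Lψ μ xs) (y : E) :
    μ / 2 * ‖y - xs‖ ^ 2 ≤ φ y + ψ y - (φ xs + ψ xs) := by
  simpa [P.stationary] using P.strong xs y

theorem gap_le_inner (P : CompositeProblem φ ψ H Lψ μ xs) (y u : E) :
    φ y + ψ y - (φ u + ψ u) ≤ ⟪∇ φ y + ∇ ψ y, y - u⟫ := by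
  have h := P.strong y u
  rw [← neg_sub y u, inner_neg_right, norm_neg] at h
  have : 0 ≤ μ / 2 * ‖y - u‖ ^ 2 := by have := P.μ_pos; positivity
  linarith

/-- The potential of the Accelerated Meta-Algorithm after one iteration whose auxiliary problem
is solved up to a residual `ρ`. -/
theorem potential_step (P : CompositeProblem φ ψ H Lψ μ xs) {w y y₀ z₀ : E} {A a ρ : ℝ}
    (hA : 0 ≤ A) (ha : 0 < a) (haA : a ^ 2 = 1 / (2 * H) * (A + a))
    (hw : (A + a) • w = A • y₀ + a • z₀)
    (hr : ‖∇ φ w + ∇ ψ y + H • (y - w)‖ ≤ ρ) :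
    (A + a) * (φ y + ψ y - (φ xs + ψ xs)) +
        1 / 2 * ‖z₀ - a • ∇ φ y - a • ∇ ψ y - xs‖ ^ 2 ≤
      A * (φ y₀ + ψ y₀ - (φ xs + ψ xs)) + 1 / 2 * ‖z₀ - xs‖ ^ 2 +
        8 / 7 * (1 / (2 * H)) * ρ ^ 2 * (A + a) := by
  have hH := P.H_pos
  set η := 1 / (2 * H) with hη
  have hη0 : 0 < η := by positivity
  have hηH : η * H = 1 / 2 := by rw [hη]; field_simp
  set g := ∇ φ y + ∇ ψ y with hg
  set D := ‖y - w‖ with hD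
  -- Since ηH = 1/2, the iterate is nearly an implicit gradient step: 1/2 comes from the proximal
  -- term and 1/4 from the H/2-smoothness of φ. Only 3/4 < 1 matters.
  have h1 : ‖η • g + (y - w)‖ ≤ 3 / 4 * D + η * ρ := by
    have e : η • g + (y - w) = (1 / 2 : ℝ) • (y - w) + η • (∇ φ y - ∇ φ w) +
        η • (∇ φ w + ∇ ψ y + H • (y - w)) := by
      rw [smul_add η _ (H • (y - w)), smul_smul, hηH, hg]; module
    rw [e]
    refine (norm_add₃_le).trans ?_
    simp only [norm_smul, Real.norm_of_nonneg hη0.le]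
    have h2 := mul_le_mul_of_nonneg_left (P.lipφ w y) hη0.le
    have h3 := mul_le_mul_of_nonneg_left hr hη0.le
    have h4 : η * (H / 2 * ‖y - w‖) = 1 / 4 * D := by
      rw [hD]; linear_combination (‖y - w‖ / 2) * hηH
    have h5 : ‖(1 / 2 : ℝ)‖ = 1 / 2 := by norm_num
    rw [h5]; linarith
  -- The maximum of (3D/4 + e)² - D² over D is 16e²/7, attained at D = 12e/7.
  have h2 : ‖η • g + (y - w)‖ ^ 2 - D ^ 2 ≤ 16 / 7 * (η * ρ) ^ 2 := by
    have := pow_le_pow_left₀ (norm_nonneg _) h1 2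
    nlinarith [sq_nonneg (7 * D - 12 * (η * ρ))]
  have h3 : ‖η • g + (y - w)‖ ^ 2 - D ^ 2 = 2 * η * ⟪g, y - w⟫ + η ^ 2 * ‖g‖ ^ 2 := by
    rw [norm_add_sq_real, norm_smul, Real.norm_of_nonneg hη0.le, inner_smul_left]
    simp; ring
  have h4 : ‖z₀ - a • ∇ φ y - a • ∇ ψ y - xs‖ ^ 2 =
      ‖z₀ - xs‖ ^ 2 - 2 * a * ⟪g, z₀ - xs⟫ + a ^ 2 * ‖g‖ ^ 2 := by
    have e : z₀ - a • ∇ φ y - a • ∇ ψ y - xs = (z₀ - xs) - a • g := by rw [hg]; module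
    rw [e, norm_sub_sq_real, norm_smul, inner_smul_right, real_inner_comm, mul_pow,
      Real.norm_eq_abs, sq_abs]
    ring
  have h5 := P.gap_le_inner y xs
  have h6 := P.gap_le_inner y y₀
  rw [← hg] at h5 h6
  have h7 : A * ⟪g, y - y₀⟫ + a * ⟪g, y - xs⟫ = (A + a) * ⟪g, y - w⟫ + a * ⟪g, z₀ - xs⟫ := by
    simp only [← inner_smul_right, ← inner_add_right]
    congr 1
    rw [smul_sub (A + a), hw]; module
  have h8 : (A + a) * (⟪g, y - w⟫ + η / 2 * ‖g‖ ^ 2) ≤ (A + a) * (8 / 7 * η * ρ ^ 2) := by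
    refine mul_le_mul_of_nonneg_left ?_ (by positivity)
    have : 2 * η * (⟪g, y - w⟫ + η / 2 * ‖g‖ ^ 2) ≤ 2 * η * (8 / 7 * η * ρ ^ 2) := by
      rw [h3] at h2; linarith
    exact le_of_mul_le_mul_left this (by positivity)
  rw [h4, haA]
  have f5 := mul_le_mul_of_nonneg_left h5 ha.le
  have f6 := mul_le_mul_of_nonneg_left h6 hA
  linear_combination f5 + f6 + h7 + h8

end CompositeProblem

/-- The defining properties of the step parameter `(η + √(η² + 4ηA)) / 2`. -/
theorem stepParameter_spec {η A : ℝ} (hη : 0 < η) (hA : 0 ≤ A) :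
    (η + √(η ^ 2 + 4 * η * A)) / 2 ≥ η ∧
      ((η + √(η ^ 2 + 4 * η * A)) / 2) ^ 2 = η * (A + (η + √(η ^ 2 + 4 * η * A)) / 2) ∧
      ∀ k : ℕ, η * k ^ 2 / 4 ≤ A →
        η * (k + 1 : ℕ) ^ 2 / 4 ≤ A + (η + √(η ^ 2 + 4 * η * A)) / 2 := by
  set r := √(η ^ 2 + 4 * η * A) with hr
  have hr2 : r ^ 2 = η ^ 2 + 4 * η * A := Real.sq_sqrt (by positivity)
  have hr0 : 0 ≤ r := Real.sqrt_nonneg _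
  have hr1 : η ≤ r := Real.le_sqrt_of_sq_le (by nlinarith [mul_nonneg hη.le hA])
  refine ⟨by linarith, by linear_combination hr2 / 4, fun k hk => ?_⟩
  -- With r ≥ ηk the new weight is at least ηk²/4 + η(k + 1)/2, which exceeds η(k + 1)²/4.
  have hrk : η * k ≤ r := by
    refine Real.le_sqrt_of_sq_le ?_
    nlinarith [mul_le_mul_of_nonneg_left hk hη.le]
  push_cast
  nlinarith

namespace CompositeProblem

variable {φ ψ : E → ℝ} {H Lψ μ δ ε : ℝ} {xs : E}

/-- Sum the potential inequality and divide by A_N ≥ N²/(8H). Because A increases, the accumulated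
noise factors A_1 + … + A_N are at most N A_N. -/
theorem amRun_gap_le (P : CompositeProblem φ ψ H Lψ μ xs) {N : ℕ} (hN : 1 ≤ N) {z₀ out : E}
    (h : IsAMRun φ ψ H δ N z₀ out) :
    φ out + ψ out - (φ xs + ψ xs) ≤
      4 * H / N ^ 2 * ‖z₀ - xs‖ ^ 2 + 4 / 7 * ((Lψ + H) * √δ) ^ 2 / H * N := by
  obtain ⟨y, z, w, A, a, η, hA0, hy0, hz0, hstep, rfl⟩ := h
  have hH := P.H_pos
  set ρ := (Lψ + H) * √δ with hρ
  have key : ∀ k ≤ N, 0 ≤ A k ∧ 1 / (2 * H) * k ^ 2 / 4 ≤ A k ∧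
      A k * (φ (y k) + ψ (y k) - (φ xs + ψ xs)) + 1 / 2 * ‖z k - xs‖ ^ 2 ≤
        1 / 2 * ‖z₀ - xs‖ ^ 2 + 8 / 7 * (1 / (2 * H)) * ρ ^ 2 * (k * A k) := by
    intro k
    induction k with
    | zero => intro _; simp [hA0, hz0]
    | succ k ih =>
      intro hk
      obtain ⟨i1, i2, i3⟩ := ih (by omega)
      obtain ⟨e1, e2, e3, e4, e5, e6, e7⟩ := hstep k (by omega)
      have hη : η (k + 1) = 1 / (2 * H) := by
        rw [eq_div_iff (by positivity)]; linarith
      rw [hη] at e3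
      obtain ⟨s1, s2, s3⟩ := stepParameter_spec (η := 1 / (2 * H)) (A := A k) (by positivity) i1
      rw [← e3] at s1 s2 s3
      have ha : 0 < a (k + 1) := lt_of_lt_of_le (by positivity) s1
      have hA' : 0 < A (k + 1) := by rw [e4]; positivity
      have hw : (A k + a (k + 1)) • w k = A k • y k + a (k + 1) • z k := by
        rw [← e4, e5, smul_add, smul_smul, smul_smul, mul_div_cancel₀ _ hA'.ne',
          mul_div_cancel₀ _ hA'.ne']
      have hp := P.potential_step i1 ha s2 hw (P.residual_le e6)
      rw [← e7, ← e4] at hp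
      refine ⟨hA'.le, by rw [e4]; exact s3 k i2, hp.trans ?_⟩
      have h1 : (k : ℝ) * A k + A (k + 1) ≤ (k + 1 : ℕ) * A (k + 1) := by
        push_cast
        rw [e4]
        nlinarith [mul_nonneg (Nat.cast_nonneg (α := ℝ) k) ha.le]
      have h2 := mul_le_mul_of_nonneg_left h1
        (show 0 ≤ 8 / 7 * (1 / (2 * H)) * ρ ^ 2 by positivity)
      linarith
  obtain ⟨k1, k2, k3⟩ := key N le_rfl
  have hN' : (0 : ℝ) < N := by exact_mod_cast hN
  have hA : 0 < A N := lt_of_lt_of_le (by positivity) k2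
  have h1 : A N * (φ (y N) + ψ (y N) - (φ xs + ψ xs)) ≤
      A N * (‖z₀ - xs‖ ^ 2 / (2 * A N) + 8 / 7 * (1 / (2 * H)) * ρ ^ 2 * N) := by
    have h2 : A N * (‖z₀ - xs‖ ^ 2 / (2 * A N) + 8 / 7 * (1 / (2 * H)) * ρ ^ 2 * N) =
        1 / 2 * ‖z₀ - xs‖ ^ 2 + 8 / 7 * (1 / (2 * H)) * ρ ^ 2 * (N * A N) := by
      field_simp
    rw [h2]
    nlinarith [sq_nonneg ‖z N - xs‖]
  refine (le_of_mul_le_mul_left h1 hA).trans ?_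
  have h3 : ‖z₀ - xs‖ ^ 2 / (2 * A N) ≤ ‖z₀ - xs‖ ^ 2 / (2 * (1 / (2 * H) * N ^ 2 / 4)) := by
    gcongr
  have h4 : ‖z₀ - xs‖ ^ 2 / (2 * (1 / (2 * H) * N ^ 2 / 4)) = 4 * H / N ^ 2 * ‖z₀ - xs‖ ^ 2 := by
    field_simp
  have h5 : 8 / 7 * (1 / (2 * H)) * ρ ^ 2 * N = 4 / 7 * ρ ^ 2 / H * N := by
    field_simp
    ring
  linarith

/-- One iteration already contracts when the smoothness constant of `φ` is small compared with
the strong convexity constant of the sum. -/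
theorem single_step_gap_le (P : CompositeProblem φ ψ H Lψ μ xs) (hHμ : 32 * H ≤ μ) {w y : E}
    {ρ : ℝ} (hr : ‖∇ φ w + ∇ ψ y + H • (y - w)‖ ≤ ρ) :
    φ y + ψ y - (φ xs + ψ xs) ≤ μ / 8 * ‖w - xs‖ ^ 2 + 4 / μ * ρ ^ 2 := by
  have hH := P.H_pos
  have hμ := P.μ_pos
  set g := ∇ φ y + ∇ ψ y with hg
  have h1 : ‖g‖ ≤ 3 / 2 * H * ‖y - w‖ + ρ := by
    have e : g = (∇ φ y - ∇ φ w) - H • (y - w) + (∇ φ w + ∇ ψ y + H • (y - w)) := by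
      rw [hg]; abel
    rw [e]
    refine (norm_add_le _ _).trans (add_le_add ?_ hr)
    refine (norm_sub_le _ _).trans ?_
    rw [norm_smul, Real.norm_of_nonneg hH.le]
    linarith [P.lipφ w y]
  have h2 : ‖y - w‖ ≤ ‖y - xs‖ + ‖w - xs‖ := by
    rw [norm_sub_rev w xs]; exact norm_sub_le_norm_sub_add_norm_sub y xs w
  have hi : ⟪g, y - xs⟫ ≤ ‖g‖ * ‖y - xs‖ := real_inner_le_norm _ _
  have hgap := P.strong y xs
  rw [← hg, ← neg_sub y xs, inner_neg_right, norm_neg] at hgap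
  have hlow := P.dist_sq_le_gap y
  set d := ‖y - xs‖ with hd
  set R := ‖w - xs‖ with hR
  have hd0 : 0 ≤ d := norm_nonneg _
  have hR0 : 0 ≤ R := norm_nonneg _
  have hg0 : 0 ≤ ‖g‖ := norm_nonneg _
  have hμd : μ * d ≤ ‖g‖ := by
    rcases hd0.eq_or_lt with h | h
    · rw [← h]; simp
    · refine le_of_mul_le_mul_right ?_ h
      nlinarith
  have hHd : 3 / 2 * H * ‖y - w‖ ≤ 3 / 64 * (μ * d + μ * R) := by
    have : H * ‖y - w‖ ≤ μ / 32 * (d + R) :=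
      mul_le_mul (by linarith) h2 (norm_nonneg _) (by positivity)
    linarith
  -- As μd ≤ ‖g‖, the term 3μd/64 moves to the left; then 3/61 ≤ 1/20 and 64/61 ≤ 21/20.
  have hgb : ‖g‖ ≤ 1 / 20 * (μ * R) + 21 / 20 * ρ := by
    have : 0 ≤ μ * R := by positivity
    have hρ0 : 0 ≤ ρ := (norm_nonneg _).trans hr
    linarith
  have hE : φ y + ψ y - (φ xs + ψ xs) ≤ ‖g‖ ^ 2 / (2 * μ) := by
    rw [le_div_iff₀ (by positivity)]
    nlinarith [sq_nonneg (‖g‖ - μ * d)]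
  have hsq : ‖g‖ ^ 2 ≤ 1 / 4 * (μ * R) ^ 2 + 8 * ρ ^ 2 := by
    have := pow_le_pow_left₀ hg0 hgb 2
    nlinarith [sq_nonneg (μ * R - ρ), sq_nonneg (μ * R), sq_nonneg ρ]
  calc _ ≤ ‖g‖ ^ 2 / (2 * μ) := hE
    _ ≤ (1 / 4 * (μ * R) ^ 2 + 8 * ρ ^ 2) / (2 * μ) := by gcongr
    _ = μ / 8 * R ^ 2 + 4 / μ * ρ ^ 2 := by field_simp; ring

/-- The restart length satisfies N² ≥ 32H/μ, which is what turns 4H/N² into μ/8; the constant 864²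
leaves ample room for the noise. -/
theorem stage_gap_le (P : CompositeProblem φ ψ H Lψ μ xs) (hε : 0 ≤ ε) (hδ : 0 ≤ δ)
    (hδε : (Lψ + H) ^ 2 * δ ≤ ε * μ / 864 ^ 2) {z₀ out : E}
    (h : IsAMRun φ ψ H δ (restartLength H μ) z₀ out) :
    φ out + ψ out - (φ xs + ψ xs) ≤ μ / 8 * ‖z₀ - xs‖ ^ 2 + ε / 8 := by
  have hH := P.H_pos
  have hμ := P.μ_pos
  have hρ : ((Lψ + H) * √δ) ^ 2 ≤ ε * μ / 864 ^ 2 := by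
    rw [mul_pow, Real.sq_sqrt hδ]; exact hδε
  set q := 2 * √(8 * H / μ) with hq
  have hq2 : q ^ 2 = 32 * H / μ := by
    rw [hq, mul_pow, Real.sq_sqrt (by positivity)]; ring
  have hq0 : 0 ≤ q := by positivity
  rcases le_or_gt q 1 with h1 | h1
  -- Here H may be arbitrarily small compared with μ, so the noise term ρ²/H of the potential bound
  -- is useless; the single-step estimate has ρ²/μ instead.
  · have hN : restartLength H μ = 1 := by
      have : ⌈q⌉₊ ≤ 1 := Nat.ceil_le.2 (by simpa using h1)
      simp [restartLength, ← hq, this]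
    rw [hN] at h
    obtain ⟨y, z, w, A, a, η, hA0, hy0, hz0, hstep, rfl⟩ := h
    obtain ⟨e1, e2, e3, e4, e5, e6, e7⟩ := hstep 0 one_pos
    have hη : η (0 + 1) = 1 / (2 * H) := by rw [eq_div_iff (by positivity)]; linarith
    rw [hη, hA0] at e3
    have s1 := (stepParameter_spec (η := 1 / (2 * H)) (A := 0) (by positivity) le_rfl).1
    rw [← e3] at s1
    have ha : 0 < a (0 + 1) := lt_of_lt_of_le (by positivity) s1
    have hw : w 0 = z₀ := by
      rw [e5, e4, hA0, hz0, zero_add (a _), div_self ha.ne']; simp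
    have hHμ : 32 * H ≤ μ := by
      have : 32 * H / μ ≤ 1 := by rw [← hq2]; exact pow_le_one₀ hq0 h1
      rwa [div_le_one hμ] at this
    have := P.single_step_gap_le hHμ (P.residual_le e6)
    rw [hw] at this
    refine this.trans ?_
    have : 4 / μ * ((Lψ + H) * √δ) ^ 2 ≤ 4 / μ * (ε * μ / 864 ^ 2) := by gcongr
    have e : 4 / μ * (ε * μ / 864 ^ 2) = 4 / 864 ^ 2 * ε := by field_simp
    linarith
  · have hN1 : 1 ≤ restartLength H μ := le_max_right _ _
    have hNq : q ≤ restartLength H μ := by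
      refine (Nat.le_ceil q).trans ?_
      exact_mod_cast le_max_left _ _
    have hN2 : (restartLength H μ : ℝ) ≤ 2 * q := by
      have : (⌈q⌉₊ : ℝ) ≤ q + 1 := (Nat.ceil_lt_add_one hq0).le
      rw [restartLength, ← hq, Nat.cast_max]
      exact max_le (by linarith) (by push_cast; linarith)
    have hgap := P.amRun_gap_le hN1 h
    generalize (restartLength H μ : ℝ) = N at hgap hNq hN2
    have f1 : 4 * H / N ^ 2 * ‖z₀ - xs‖ ^ 2 ≤ μ / 8 * ‖z₀ - xs‖ ^ 2 := by
      refine mul_le_mul_of_nonneg_right ?_ (sq_nonneg _)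
      have hN0 : 0 < N := by linarith
      rw [div_le_iff₀ (by positivity)]
      have : q ^ 2 ≤ N ^ 2 := by gcongr
      rw [hq2, div_le_iff₀ hμ] at this
      linarith
    -- From q > 1 follows N ≤ 2q ≤ 2q² = 64H/μ, so the factor H cancels in the noise.
    have f2 : 4 / 7 * ((Lψ + H) * √δ) ^ 2 / H * N ≤ 4 / 7 * (ε * μ / 864 ^ 2) / H * (64 * H / μ) := by
      have : N ≤ 64 * H / μ := by
        have : 64 * H / μ = 2 * q ^ 2 := by rw [hq2]; ring
        rw [this]; nlinarith
      have : 0 ≤ N := by linarith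
      gcongr
    have e : 4 / 7 * (ε * μ / 864 ^ 2) / H * (64 * H / μ) = 4 / 7 * 64 / 864 ^ 2 * ε := by
      field_simp
    linarith

end CompositeProblem

end Composite

/-! ### Restarts, solution of the auxiliary problems, boundedness of the trajectory -/

section Composite

variable {E : Type} [NormedAddCommGroup E] [InnerProductSpace ℝ E] [CompleteSpace E]

namespace CompositeProblem

variable {φ ψ : E → ℝ} {H Lψ μ δ ε : ℝ} {xs : E}

theorem stage_dist_sq_le (P : CompositeProblem φ ψ H Lψ μ xs) (hε : 0 ≤ ε) (hδ : 0 ≤ δ)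
    (hδε : (Lψ + H) ^ 2 * δ ≤ ε * μ / 864 ^ 2) {z₀ out : E}
    (h : IsAMRun φ ψ H δ (restartLength H μ) z₀ out) :
    ‖out - xs‖ ^ 2 ≤ ‖z₀ - xs‖ ^ 2 / 4 + ε / (4 * μ) := by
  have hμ := P.μ_pos
  have h1 := (P.dist_sq_le_gap out).trans (P.stage_gap_le hε hδ hδε h)
  refine le_of_mul_le_mul_left ?_ (half_pos hμ)
  have e : μ / 2 * (‖z₀ - xs‖ ^ 2 / 4 + ε / (4 * μ)) = μ / 8 * ‖z₀ - xs‖ ^ 2 + ε / 8 := by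
    field_simp; ring
  rw [e]; exact h1

/-- The error of the restarted method after `s` stages. -/
theorem restarted_gap_le (P : CompositeProblem φ ψ H Lψ μ xs) (hε : 0 ≤ ε) (hδ : 0 ≤ δ)
    (hδε : (Lψ + H) ^ 2 * δ ≤ ε * μ / 864 ^ 2) {s : ℕ} (hs : 1 ≤ s) {z₀ out : E}
    (h : IsRAMRun φ ψ H δ (restartLength H μ) s z₀ out) :
    φ out + ψ out - (φ xs + ψ xs) ≤ μ / 2 * ((1 / 4) ^ s * ‖z₀ - xs‖ ^ 2) + ε / 6 := by
  have hμ := P.μ_pos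
  obtain ⟨ζ, h0, hrun, rfl⟩ := h
  -- ε/(3μ) is the fixed point of t ↦ t/4 + ε/(4μ).
  have hR : ∀ k ≤ s, ‖ζ k - xs‖ ^ 2 ≤ (1 / 4) ^ k * ‖z₀ - xs‖ ^ 2 + ε / (3 * μ) := by
    intro k
    induction k with
    | zero =>
      intro _
      have : 0 ≤ ε / (3 * μ) := by positivity
      simpa [h0] using this
    | succ k ih =>
      intro hk
      have h1 := P.stage_dist_sq_le hε hδ hδε (hrun k (by omega))
      have h2 := ih (by omega)
      have e : ε / (4 * μ) = ε / (3 * μ) - ε / (3 * μ) / 4 := by field_simp; norm_num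
      rw [pow_succ (1 / 4 : ℝ) k]
      linarith
  -- The last stage is measured in function values, directly from the distance before it: ε/24 + ε/8
  -- = ε/6.
  obtain ⟨s, rfl⟩ : ∃ t, s = t + 1 := ⟨s - 1, by omega⟩
  have h1 := P.stage_gap_le hε hδ hδε (hrun s (by omega))
  have h2 := mul_le_mul_of_nonneg_left (hR s (by omega)) (show 0 ≤ μ / 8 by positivity)
  have e : μ / 8 * ((1 / 4) ^ s * ‖z₀ - xs‖ ^ 2 + ε / (3 * μ)) =
      μ / 2 * ((1 / 4) ^ (s + 1) * ‖z₀ - xs‖ ^ 2) + ε / 24 := by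
    rw [pow_succ]; field_simp; ring
  linarith

/-- Subtract the stationarity condition of `xs` from that of `y` and pair with y - xs: monotonicity
of ∇ψ removes the ψ-terms, and H + H/2 bounds the rest. -/
theorem aux_minimizer_dist_le (P : CompositeProblem φ ψ H Lψ μ xs) {w y : E}
    (h : ∀ u, auxObjective φ ψ H w y ≤ auxObjective φ ψ H w u) :
    ‖y - xs‖ ≤ 3 / 2 * ‖w - xs‖ := by
  have hH := P.H_pos
  have h0 := P.aux_stationary h
  set p := y - xs with hp
  have e : H • p = (H • (w - xs) - (∇ φ w - ∇ φ xs)) - (∇ ψ y - ∇ ψ xs) := by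
    rw [← sub_zero (_ - (∇ ψ y - ∇ ψ xs)), ← P.stationary,
      ← add_zero (_ - (∇ φ xs + ∇ ψ xs)), ← h0, hp]
    module
  have hmono : 0 ≤ ⟪∇ ψ y - ∇ ψ xs, p⟫ := by
    have h1 := P.convψ xs y
    have h2 := P.convψ y xs
    rw [← neg_sub y xs, inner_neg_right] at h2
    rw [inner_sub_left, hp]
    linarith
  have h1 : H * ‖p‖ ^ 2 ≤ (3 / 2 * H * ‖w - xs‖) * ‖p‖ := by
    have h2 : H * ‖p‖ ^ 2 = ⟪H • p, p⟫ := by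
      rw [inner_smul_left, real_inner_self_eq_norm_sq]; simp
    rw [h2, e, inner_sub_left]
    have h3 : ⟪H • (w - xs) - (∇ φ w - ∇ φ xs), p⟫ ≤ (3 / 2 * H * ‖w - xs‖) * ‖p‖ := by
      refine (real_inner_le_norm _ _).trans ?_
      refine mul_le_mul_of_nonneg_right ?_ (norm_nonneg _)
      refine (norm_sub_le _ _).trans ?_
      rw [norm_smul, Real.norm_of_nonneg hH.le]
      linarith [P.lipφ xs w]
    linarith
  rcases (norm_nonneg p).eq_or_lt with h2 | h2
  · rw [← h2]; positivity
  · refine le_of_mul_le_mul_left ?_ (mul_pos hH h2)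
    nlinarith

theorem solvesAux_dist_le (P : CompositeProblem φ ψ H Lψ μ xs) (hδ : δ ≤ 1) {w y : E}
    (h : SolvesAux φ ψ H δ w y) : ‖y - xs‖ ≤ 2 * ‖w - xs‖ + 1 := by
  obtain ⟨ys, hmin, hd⟩ := h
  have h1 := P.aux_minimizer_dist_le hmin
  have h2 : ‖y - ys‖ ≤ 1 := by
    rw [← sq_le_one_iff₀ (norm_nonneg _)]; exact hd.trans hδ
  have h3 := norm_sub_le_norm_sub_add_norm_sub y ys xs
  linarith [norm_nonneg (w - xs)]

theorem gradient_norm_le (P : CompositeProblem φ ψ H Lψ μ xs) (y : E) :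
    ‖∇ φ y + ∇ ψ y‖ ≤ (H / 2 + Lψ) * ‖y - xs‖ := by
  have e : ∇ φ y + ∇ ψ y = (∇ φ y - ∇ φ xs) + (∇ ψ y - ∇ ψ xs) := by
    rw [← sub_zero (∇ φ y + ∇ ψ y), ← P.stationary]; abel
  rw [e]
  refine (norm_add_le _ _).trans ?_
  linarith [P.lipφ xs y, P.lipψ xs y]

/-- Beyond radius 2‖c‖/H the quadratic term outweighs the linear lower bound given by convexity of
ψ, so a minimizer on the compact ball is global. -/
theorem exists_aux_minimizer [FiniteDimensional ℝ E] (P : CompositeProblem φ ψ H Lψ μ xs)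
    (w : E) : ∃ y, ∀ u, auxObjective φ ψ H w y ≤ auxObjective φ ψ H w u := by
  have hH := P.H_pos
  have : ProperSpace E := FiniteDimensional.proper_real E
  have hcont : Continuous (auxObjective φ ψ H w) :=
    continuous_iff_continuousAt.2 fun y => (hasFDerivAt_auxObjective P.diffψ H w y).continuousAt
  set c := ∇ φ w + ∇ ψ w with hc
  set r := 2 * ‖c‖ / H with hr
  have hr0 : 0 ≤ r := by positivity
  obtain ⟨y, -, hy⟩ := (isCompact_closedBall w r).exists_isMinOn
    ⟨w, Metric.mem_closedBall_self hr0⟩ hcont.continuousOn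
  refine ⟨y, fun u => ?_⟩
  rcases le_or_gt (dist u w) r with h | h
  · exact hy h
  · refine (hy (Metric.mem_closedBall_self hr0) : auxObjective φ ψ H w y ≤ _).trans ?_
    rw [dist_eq_norm, hr, div_lt_iff₀ hH] at h
    have h1 := P.convψ w u
    have h2 : -(‖c‖ * ‖u - w‖) ≤ ⟪c, u - w⟫ := neg_le_of_abs_le (abs_real_inner_le_norm _ _)
    rw [hc, inner_add_left] at h2
    simp only [auxObjective, sub_self, inner_zero_right, norm_zero]
    nlinarith [norm_nonneg (u - w)]

/-- Nesterov's method solves the auxiliary problems at all points of a ball around the solution.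
The gradient of `ψ` takes values in `K`, and `ψ` is `mψ`-strongly convex in the directions of `K`
only. -/
theorem innerSolver_solvesAux [FiniteDimensional ℝ E] (P : CompositeProblem φ ψ H Lψ μ xs)
    {K : Submodule ℝ E} {mψ B : ℝ} {T : ℕ} (hm : 0 ≤ mψ) (hmL : mψ ≤ Lψ)
    (hK : ∀ v, ∇ ψ v ∈ K)
    (hstrong : ∀ u v, u - v ∈ K → ⟪∇ ψ v, u - v⟫ + mψ / 2 * ‖u - v‖ ^ 2 ≤ ψ u - ψ v)
    (hT : 4 * ((H + Lψ) / (H + mψ)) * Real.exp (-(√((H + mψ) / (H + Lψ)) * T)) *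
      ((3 / 2 * Lψ * B + ‖∇ ψ xs‖) / H) ^ 2 ≤ δ)
    {w : E} (hw : ‖w - xs‖ ≤ B) :
    SolvesAux φ ψ H δ w (innerSolver (∇ φ) (∇ ψ) H (H + Lψ) (H + mψ) T w) := by
  have hH := P.H_pos
  have hL := P.Lψ_nonneg
  obtain ⟨ys, hys⟩ := P.exists_aux_minimizer w
  refine ⟨ys, hys, ?_⟩
  have h0 := P.aux_stationary hys
  set x₀ := w - (1 / H) • ∇ φ w with hx₀
  have hHx₀ : H • (w - x₀) = ∇ φ w := by
    rw [hx₀, sub_sub_cancel, smul_smul, mul_one_div_cancel hH.ne', one_smul]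
  -- Centred at `x₀`, the auxiliary gradient lies in K as soon as v - x₀ does; the same identity at
  -- the minimizer puts it in x₀ + K.
  have hGx : ∀ v, ∇ φ w + ∇ ψ v + H • (v - w) = ∇ ψ v + H • (v - x₀) := by
    intro v; rw [← hHx₀]; module
  have hys0 : H • (ys - x₀) = -∇ ψ ys := by
    rw [hGx] at h0; exact eq_neg_of_add_eq_zero_right h0
  have hysK : ys - x₀ ∈ K := by
    have : ys - x₀ = (1 / H) • (H • (ys - x₀)) := by
      rw [smul_smul, one_div_mul_cancel hH.ne', one_smul]
    rw [this, hys0]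
    exact K.smul_mem _ (K.neg_mem (hK _))
  have hsub : ∀ {u v : E}, u - x₀ ∈ K → v - x₀ ∈ K → u - v ∈ K := by
    intro u v hu hv
    simpa using K.sub_mem hu hv
  have hlip : ∀ x y, ‖(∇ φ w + ∇ ψ y + H • (y - w)) - (∇ φ w + ∇ ψ x + H • (x - w))‖ ≤
      (H + Lψ) * ‖y - x‖ := by
    intro x y
    have e : (∇ φ w + ∇ ψ y + H • (y - w)) - (∇ φ w + ∇ ψ x + H • (x - w)) =
        (∇ ψ y - ∇ ψ x) + H • (y - x) := by module
    rw [e]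
    refine (norm_add_le _ _).trans ?_
    rw [norm_smul, Real.norm_of_nonneg hH.le]
    linarith [P.lipψ x y]
  have hnest := nesterovIter_dist_sq_le (Φ := auxObjective φ ψ H w)
    (G := fun y => ∇ φ w + ∇ ψ y + H • (y - w)) (K := K) (Li := H + Lψ) (mi := H + mψ)
    (x₀ := x₀) (xs := ys) (by positivity) (by linarith)
    (fun v hv => by
      simp only [hGx]
      exact K.add_mem (hK v) (K.smul_mem _ hv))
    (fun u v hu hv => by
      have h1 := hstrong u v (hsub hu hv)
      have e : ‖u - w‖ ^ 2 = ‖v - w‖ ^ 2 + 2 * ⟪v - w, u - v⟫ + ‖u - v‖ ^ 2 := by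
        rw [← norm_add_sq_real]; congr 2; abel
      have e2 : ⟪∇ φ w, u - w⟫ = ⟪∇ φ w, v - w⟫ + ⟪∇ φ w, u - v⟫ := by
        rw [← inner_add_right]; congr 1; abel
      simp only [auxObjective, e, e2, inner_add_left, inner_smul_left, RCLike.conj_to_real]
      linarith)
    (fun v => by
      have h1 := le_quadratic_of_lipschitz_gradient
        (fun y => hasFDerivAt_auxObjective (φ := φ) P.diffψ H w y) hlip v
        (v - (1 / (H + Lψ)) • (∇ φ w + ∇ ψ v + H • (v - w)))
      generalize ∇ φ w + ∇ ψ v + H • (v - w) = g at h1 ⊢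
      have hp : 0 < H + Lψ := by positivity
      rw [sub_sub_cancel_left, inner_neg_right, inner_smul_right, norm_neg, norm_smul,
        real_inner_self_eq_norm_sq, Real.norm_of_nonneg (by positivity)] at h1
      refine h1.trans (le_of_eq ?_)
      field_simp
      ring)
    hysK h0
    (by
      have := hlip ys x₀
      rwa [h0, sub_zero] at this) T
  refine hnest.trans (le_trans ?_ hT)
  -- The initial distance is exactly ‖∇ψ(ys)‖/H, and `ys` is within 3B/2 of `xs`.
  have hD : ‖x₀ - ys‖ ≤ (3 / 2 * Lψ * B + ‖∇ ψ xs‖) / H := by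
    rw [le_div_iff₀ hH]
    have h1 : ‖x₀ - ys‖ * H = ‖∇ ψ ys‖ := by
      rw [← norm_neg (∇ ψ ys), ← hys0, norm_smul, Real.norm_of_nonneg hH.le, norm_sub_rev, mul_comm]
    rw [h1]
    have h2 : ‖∇ ψ ys‖ ≤ ‖∇ ψ ys - ∇ ψ xs‖ + ‖∇ ψ xs‖ := by
      simpa using norm_add_le (∇ ψ ys - ∇ ψ xs) (∇ ψ xs)
    have h3 := mul_le_mul_of_nonneg_left ((P.aux_minimizer_dist_le hys).trans
      (mul_le_mul_of_nonneg_left hw (by norm_num : (0 : ℝ) ≤ 3 / 2))) hL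
    linarith [P.lipψ xs ys]
  gcongr

end CompositeProblem

/-- The values of `A` along a run of the Accelerated Meta-Algorithm. -/
noncomputable def weightSeq (H : ℝ) : ℕ → ℝ
  | 0 => 0
  | k + 1 => weightSeq H k + nextWeight H (weightSeq H k)

/-- A bound for the distances of the iterates to the solution along a run of the Accelerated
Meta-Algorithm that starts at distance `R`. -/
noncomputable def radiusSeq (H Lψ R : ℝ) : ℕ → ℝ
  | 0 => R
  | k + 1 => radiusSeq H Lψ R k +
      (1 + nextWeight H (weightSeq H k) * (H / 2 + Lψ)) * (2 * radiusSeq H Lψ R k + 1)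

theorem nextWeight_pos {H : ℝ} (hH : 0 < H) {A : ℝ} (hA : 0 ≤ A) : 0 < nextWeight H A :=
  lt_of_lt_of_le (by positivity) (stepParameter_spec (η := 1 / (2 * H)) (by positivity) hA).1

theorem weightSeq_nonneg {H : ℝ} (hH : 0 < H) (k : ℕ) : 0 ≤ weightSeq H k := by
  induction k with
  | zero => exact le_rfl
  | succ k ih => exact add_nonneg ih (nextWeight_pos hH ih).le

theorem radiusSeq_nonneg {H Lψ R : ℝ} (hH : 0 < H) (hL : 0 ≤ Lψ) (hR : 0 ≤ R) (k : ℕ) :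
    0 ≤ radiusSeq H Lψ R k := by
  induction k with
  | zero => exact hR
  | succ k ih =>
    have := nextWeight_pos hH (weightSeq_nonneg hH k)
    rw [radiusSeq]; positivity

theorem radiusSeq_mono {H Lψ R : ℝ} (hH : 0 < H) (hL : 0 ≤ Lψ) (hR : 0 ≤ R) :
    Monotone (radiusSeq H Lψ R) := by
  refine monotone_nat_of_le_succ fun k => ?_
  have := nextWeight_pos hH (weightSeq_nonneg hH k)
  have := radiusSeq_nonneg hH hL hR k
  rw [radiusSeq]
  exact le_add_of_nonneg_right (by positivity)

namespace CompositeProblem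

variable {φ ψ : E → ℝ} {H Lψ μ δ ε : ℝ} {xs : E}

/-- The solver is accurate only on a ball, so the two claims are interlocked: the radius bound at
step k makes the solve at step k accurate, and this accuracy gives the radius bound at step k + 1.
-/
theorem amIter_isAMRun (P : CompositeProblem φ ψ H Lψ μ xs) (hδ : δ ≤ 1) {S : E → E} {R : ℝ}
    {N : ℕ} (hS : ∀ w, ‖w - xs‖ ≤ radiusSeq H Lψ R N → SolvesAux φ ψ H δ w (S w)) {z₀ : E}
    (hz₀ : ‖z₀ - xs‖ ≤ R) :
    IsAMRun φ ψ H δ N z₀ (amIter (∇ φ) (∇ ψ) H S N z₀) := by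
  have hH := P.H_pos
  have hL := P.Lψ_nonneg
  have hR : 0 ≤ R := (norm_nonneg _).trans hz₀
  set U := amUpdate (∇ φ) (∇ ψ) H S with hU
  set st : ℕ → AMState E := fun k => U^[k] ⟨z₀, z₀, 0⟩ with hst
  have hsucc : ∀ k, st (k + 1) = U (st k) := fun k => Function.iterate_succ_apply' U k _
  have hquery : ∀ k (x y : E) , ‖x - xs‖ ≤ radiusSeq H Lψ R k → ‖y - xs‖ ≤ radiusSeq H Lψ R k →
      ‖AMState.query H ⟨x, y, weightSeq H k⟩ - xs‖ ≤ radiusSeq H Lψ R k := by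
    intro k x y hx hy
    have hA := weightSeq_nonneg hH k
    have ha := nextWeight_pos hH hA
    simp only [AMState.query]
    generalize weightSeq H k = A at hA ha
    generalize nextWeight H A = a at ha
    have h1 : A / (A + a) + a / (A + a) = 1 := by field_simp
    have e : (A / (A + a)) • x + (a / (A + a)) • y - xs =
        (A / (A + a)) • (x - xs) + (a / (A + a)) • (y - xs) := by
      have h2 : xs = (A / (A + a) + a / (A + a)) • xs := by rw [h1, one_smul]
      nth_rewrite 1 [h2]
      module
    rw [e]
    refine (norm_add_le _ _).trans ?_
    rw [norm_smul, norm_smul, Real.norm_of_nonneg (by positivity),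
      Real.norm_of_nonneg (by positivity)]
    calc _ ≤ A / (A + a) * radiusSeq H Lψ R k + a / (A + a) * radiusSeq H Lψ R k := by gcongr
      _ = radiusSeq H Lψ R k := by rw [← add_mul, h1, one_mul]
  have key : ∀ k ≤ N, (st k).A = weightSeq H k ∧ ‖(st k).y - xs‖ ≤ radiusSeq H Lψ R k ∧
      ‖(st k).z - xs‖ ≤ radiusSeq H Lψ R k := by
    intro k
    induction k with
    | zero => exact fun _ => ⟨rfl, hz₀, hz₀⟩
    | succ k ih =>
      intro hk
      obtain ⟨i1, i2, i3⟩ := ih (by omega)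
      rw [hsucc]
      generalize st k = t at i1 i2 i3
      obtain ⟨y, z, A⟩ := t
      simp only at i1 i2 i3
      subst i1
      have hq := hquery k y z i2 i3
      have hA := weightSeq_nonneg hH k
      have ha := nextWeight_pos hH hA
      have hs := P.solvesAux_dist_le hδ
        (hS _ (hq.trans (radiusSeq_mono hH hL hR (by omega : k ≤ N))))
      have hB := radiusSeq_nonneg hH hL hR k
      simp only [hU, amUpdate, weightSeq, radiusSeq, true_and]
      set y' := S (AMState.query H ⟨y, z, weightSeq H k⟩)
      set a := nextWeight H (weightSeq H k)
      set B := radiusSeq H Lψ R k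
      have hy' : ‖y' - xs‖ ≤ 2 * B + 1 := by linarith
      have haB : 0 ≤ a * (H / 2 + Lψ) * (2 * B + 1) := by positivity
      refine ⟨by linarith, ?_⟩
      have e : z - a • ∇ φ y' - a • ∇ ψ y' - xs = (z - xs) - a • (∇ φ y' + ∇ ψ y') := by module
      rw [e]
      refine (norm_sub_le _ _).trans ?_
      rw [norm_smul, Real.norm_of_nonneg ha.le]
      have h1 : a * ‖∇ φ y' + ∇ ψ y'‖ ≤ a * ((H / 2 + Lψ) * (2 * B + 1)) := by
        gcongr
        exact (P.gradient_norm_le y').trans (by gcongr)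
      linarith
  -- The weight with index k + 1 is computed from state k, hence the shift k - 1; its value at 0
  -- plays no role.
  refine ⟨fun k => (st k).y, fun k => (st k).z, fun k => (st k).query H, fun k => (st k).A,
    fun k => nextWeight H (st (k - 1)).A, fun _ => 1 / (2 * H), rfl, rfl, rfl, fun k hk => ?_, rfl⟩
  obtain ⟨i1, i2, i3⟩ := key k hk.le
  have hη : 1 / (2 * H) * H = 1 / 2 := by field_simp
  have hsol : SolvesAux φ ψ H δ ((st k).query H) (S ((st k).query H)) := by
    refine hS _ ?_
    have := hquery k _ _ i2 i3
    rw [← i1] at this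
    exact this.trans (radiusSeq_mono hH hL hR hk.le)
  simp only [Nat.add_sub_cancel, hsucc]
  exact ⟨hη.ge, hη.le, rfl, rfl, rfl, hsol, rfl⟩

/-- Stage outputs never leave the ball of radius ‖z₀ - xs‖ + 1, because (R + 1)²/4 + 1/4 ≤ (R + 1)².
One radius therefore serves all stages, whatever `s` is. -/
theorem iterate_amIter_isRAMRun (P : CompositeProblem φ ψ H Lψ μ xs) (hε : 0 ≤ ε) (hεμ : ε ≤ μ)
    (hδ : 0 ≤ δ) (hδ1 : δ ≤ 1) (hδε : (Lψ + H) ^ 2 * δ ≤ ε * μ / 864 ^ 2) {S : E → E} {z₀ : E}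
    (hS : ∀ w, ‖w - xs‖ ≤ radiusSeq H Lψ (‖z₀ - xs‖ + 1) (restartLength H μ) →
      SolvesAux φ ψ H δ w (S w)) (s : ℕ) :
    IsRAMRun φ ψ H δ (restartLength H μ) s z₀
      ((amIter (∇ φ) (∇ ψ) H S (restartLength H μ))^[s] z₀) := by
  set I := amIter (∇ φ) (∇ ψ) H S (restartLength H μ) with hI
  have hrun : ∀ k, ‖I^[k] z₀ - xs‖ ≤ ‖z₀ - xs‖ + 1 ∧
      IsAMRun φ ψ H δ (restartLength H μ) (I^[k] z₀) (I^[k + 1] z₀) := by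
    intro k
    induction k with
    | zero =>
      have h0 : ‖I^[0] z₀ - xs‖ ≤ ‖z₀ - xs‖ + 1 := by simp
      exact ⟨h0, P.amIter_isAMRun hδ1 hS h0⟩
    | succ k ih =>
      have h1 := P.stage_dist_sq_le hε hδ hδε ih.2
      have h2 : ε / (4 * μ) ≤ 1 / 4 := by
        rw [div_le_iff₀ (by linarith [P.μ_pos])]; linarith
      have h0 : ‖I^[k + 1] z₀ - xs‖ ≤ ‖z₀ - xs‖ + 1 := by
        have hz := norm_nonneg (z₀ - xs)
        have h3 := pow_le_pow_left₀ (norm_nonneg _) ih.1 2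
        refine (sq_le_sq₀ (norm_nonneg _) (by positivity)).1 ?_
        nlinarith
      refine ⟨h0, ?_⟩
      rw [Function.iterate_succ_apply' I (k + 1)]
      exact P.amIter_isAMRun hδ1 hS h0
  exact ⟨fun k => I^[k] z₀, rfl, fun k _ => (hrun k).2, rfl⟩

end CompositeProblem

end Composite

/-! ### Spectral bounds for positive symmetric operators -/

section Spectrum

variable {E : Type} [NormedAddCommGroup E] [InnerProductSpace ℝ E] {T : E →ₗ[ℝ] E}

theorem hasEigenvalue_nonneg (hpos : ∀ x, 0 ≤ ⟪T x, x⟫) {r : ℝ}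
    (hr : Module.End.HasEigenvalue T r) : 0 ≤ r :=
  eigenvalue_nonneg_of_nonneg hr fun x => by simpa [real_inner_comm] using hpos x

variable [FiniteDimensional ℝ E]

theorem inner_eigenvectorBasis_apply (hT : T.IsSymmetric) {m : ℕ}
    (hm : Module.finrank ℝ E = m) (x : E) (i : Fin m) :
    ⟪hT.eigenvectorBasis hm i, T x⟫ = hT.eigenvalues hm i * ⟪hT.eigenvectorBasis hm i, x⟫ := by
  simpa [OrthonormalBasis.repr_apply_apply] using hT.eigenvectorBasis_apply_self_apply hm x i

theorem hasEigenvalue_le_sSup {r : ℝ} (hr : Module.End.HasEigenvalue T r) :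
    r ≤ sSup {r : ℝ | Module.End.HasEigenvalue T r} :=
  le_csSup (Module.End.finite_hasEigenvalue T).bddAbove hr

theorem norm_apply_le_sSup_eigenvalues (hT : T.IsSymmetric) (hpos : ∀ x, 0 ≤ ⟪T x, x⟫) (x : E) :
    ‖T x‖ ≤ sSup {r : ℝ | Module.End.HasEigenvalue T r} * ‖x‖ := by
  have hS : 0 ≤ sSup {r : ℝ | Module.End.HasEigenvalue T r} :=
    Real.sSup_nonneg fun r hr => hasEigenvalue_nonneg hpos hr
  refine (sq_le_sq₀ (norm_nonneg _) (by positivity)).1 ?_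
  rw [mul_pow, ← (hT.eigenvectorBasis rfl).sum_sq_norm_inner_right (T x),
    ← (hT.eigenvectorBasis rfl).sum_sq_norm_inner_right x, Finset.mul_sum]
  refine Finset.sum_le_sum fun i _ => ?_
  rw [inner_eigenvectorBasis_apply, norm_mul, mul_pow]
  have h1 := hT.hasEigenvalue_eigenvalues rfl i
  have h2 := hasEigenvalue_nonneg hpos h1
  rw [Real.norm_of_nonneg (show 0 ≤ hT.eigenvalues rfl i from h2)]
  gcongr
  exact hasEigenvalue_le_sSup h1

/-- On its range, a positive symmetric operator is bounded below by its smallest positive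
eigenvalue. -/
theorem sInf_eigenvalues_mul_le_inner (hT : T.IsSymmetric) (hpos : ∀ x, 0 ≤ ⟪T x, x⟫) {x : E}
    (hx : x ∈ LinearMap.range T) :
    sInf {r : ℝ | 0 < r ∧ Module.End.HasEigenvalue T r} * ‖x‖ ^ 2 ≤ ⟪T x, x⟫ := by
  obtain ⟨y, rfl⟩ := hx
  rw [← (hT.eigenvectorBasis rfl).sum_sq_norm_inner_right (T y), Finset.mul_sum,
    ← (hT.eigenvectorBasis rfl).sum_inner_mul_inner (T (T y))]
  refine Finset.sum_le_sum fun i _ => ?_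
  rw [real_inner_comm (hT.eigenvectorBasis rfl i) (T (T y)),
    inner_eigenvectorBasis_apply hT rfl (T y), Real.norm_eq_abs, sq_abs, mul_assoc,
    ← sq]
  have h1 := hT.hasEigenvalue_eigenvalues rfl i
  -- On an eigenvector of eigenvalue 0 the vector T y has no component, so only positive eigenvalues
  -- contribute.
  rcases (show 0 ≤ hT.eigenvalues rfl i from hasEigenvalue_nonneg hpos h1).eq_or_lt with h2 | h2
  · rw [inner_eigenvectorBasis_apply, ← h2]; simp
  · refine mul_le_mul_of_nonneg_right ?_ (sq_nonneg _)
    exact csInf_le ⟨0, fun r hr => hr.1.le⟩ ⟨h2, h1⟩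

/-- The infimum of the empty set would be 0. If no eigenvalue were positive, T would vanish on an
eigenbasis; otherwise the set is finite and nonempty. -/
theorem sInf_eigenvalues_mem (hT : T.IsSymmetric) (hpos : ∀ x, 0 ≤ ⟪T x, x⟫) (h0 : T ≠ 0) :
    sInf {r : ℝ | 0 < r ∧ Module.End.HasEigenvalue T r} ∈
      {r : ℝ | 0 < r ∧ Module.End.HasEigenvalue T r} := by
  refine Set.Nonempty.csInf_mem ?_
    ((Module.End.finite_hasEigenvalue T).subset fun r hr => hr.2)
  by_contra hne
  refine h0 ((hT.eigenvectorBasis rfl).toBasis.ext fun i => ?_)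
  have h1 := hT.hasEigenvalue_eigenvalues rfl i
  have h2 : (hT.eigenvalues rfl i) = 0 := by
    by_contra h3
    exact hne ⟨_, lt_of_le_of_ne (hasEigenvalue_nonneg hpos h1) (Ne.symm h3), h1⟩
  have h4 := hT.apply_eigenvectorBasis rfl i
  rw [h2] at h4
  simpa using h4

theorem hasGradientAt_quadratic [CompleteSpace E] (hT : T.IsSymmetric) {lam : ℝ} (x : E) :
    HasGradientAt (fun x => lam / 2 * ⟪x, T x⟫) (lam • T x) x := by
  have hW : HasFDerivAt (fun x => T x) (LinearMap.toContinuousLinearMap T) x :=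
    (LinearMap.toContinuousLinearMap T).hasFDerivAt
  have h1 := (HasFDerivAt.inner ℝ (hasFDerivAt_id x) hW).const_mul (lam / 2)
  rw [hasGradientAt_iff_hasFDerivAt]
  refine h1.congr_fderiv ?_
  ext v
  have h2 : ⟪x, T v⟫ = ⟪T x, v⟫ := (hT x v).symm
  simp [h2, real_inner_comm]
  ring

end Spectrum

/-! ### The communication operator of a gossip matrix -/

section Gossip

variable {n d : ℕ} {G : SimpleGraph (Fin n)} {What : Matrix (Fin n) (Fin n) ℝ}

theorem commOp_apply (x : Stacked n d) (i : Fin n) :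
    commOp d What x i = ∑ j, What i j • x j := rfl

theorem inner_commOp (x y : Stacked n d) :
    ⟪commOp d What x, y⟫ = ∑ i, ∑ j, What i j * ⟪x j, y i⟫ := by
  rw [PiLp.inner_apply]
  refine Finset.sum_congr rfl fun i _ => ?_
  rw [commOp_apply, sum_inner]
  simp [inner_smul_left]

theorem IsGossip.isSymmetric (h : IsGossip G What) : (commOp d What).IsSymmetric := by
  intro x y
  have hs : ∀ i j, What i j = What j i := fun i j => by
    simpa using (h.posSemidef.isHermitian.apply i j).symm
  rw [real_inner_comm (commOp d What y) x, inner_commOp, inner_commOp, Finset.sum_comm]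
  refine Finset.sum_congr rfl fun i _ => Finset.sum_congr rfl fun j _ => ?_
  rw [hs j i, real_inner_comm]

theorem IsGossip.inner_nonneg (h : IsGossip G What) (x : Stacked n d) :
    0 ≤ ⟪commOp d What x, x⟫ := by
  -- W acts separately on each of the d coordinates, as `What`.
  have e : ⟪commOp d What x, x⟫ =
      ∑ a, star (fun i => x i a) ⬝ᵥ What.mulVec (fun i => x i a) := by
    rw [inner_commOp]
    simp only [dotProduct, Matrix.mulVec, PiLp.inner_apply, Finset.mul_sum]
    conv_rhs => rw [Finset.sum_comm]
    refine Finset.sum_congr rfl fun i _ => ?_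
    rw [Finset.sum_comm]
    refine Finset.sum_congr rfl fun a _ => Finset.sum_congr rfl fun j _ => ?_
    simp; ring
  rw [e]
  exact Finset.sum_nonneg fun a _ => h.posSemidef.dotProduct_mulVec_nonneg _

/-- Otherwise a standard basis vector would lie in the kernel of `What` and be constant, impossible
for n ≥ 2. -/
theorem IsGossip.commOp_ne_zero (h : IsGossip G What) (hn : 2 ≤ n) (hd : 0 < d) :
    commOp d What ≠ 0 := by
  intro h0
  let i₀ : Fin n := ⟨0, by omega⟩
  let i₁ : Fin n := ⟨1, by omega⟩
  let a : Fin d := ⟨0, hd⟩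
  have h1 : What.mulVec (Pi.single i₀ 1) = 0 := by
    ext i
    have := congrArg (fun y : Stacked n d => y i a)
      (LinearMap.congr_fun h0 (WithLp.toLp 2 fun j => EuclideanSpace.single a
        ((Pi.single i₀ 1 : Fin n → ℝ) j)))
    simpa [commOp, Matrix.mulVec, dotProduct] using this
  obtain ⟨c, hc⟩ := (h.kernel _).1 h1
  have e0 := congrFun hc i₀
  have e1 := congrFun hc i₁
  have : i₁ ≠ i₀ := by simp [i₀, i₁]
  simp [this] at e0 e1
  linarith

theorem IsGossip.lamMinPos_pos (h : IsGossip G What) (hn : 2 ≤ n) (hd : 0 < d) :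
    0 < lamMinPos d What :=
  (sInf_eigenvalues_mem h.isSymmetric h.inner_nonneg (h.commOp_ne_zero hn hd)).1

theorem IsGossip.lamMinPos_le_lamMax (h : IsGossip G What) (hn : 2 ≤ n) (hd : 0 < d) :
    lamMinPos d What ≤ lamMax d What :=
  hasEigenvalue_le_sSup
    (sInf_eigenvalues_mem h.isSymmetric h.inner_nonneg (h.commOp_ne_zero hn hd)).2

theorem IsGossip.norm_commOp_le (h : IsGossip G What) (x : Stacked n d) :
    ‖commOp d What x‖ ≤ lamMax d What * ‖x‖ :=
  norm_apply_le_sSup_eigenvalues h.isSymmetric h.inner_nonneg x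

theorem IsGossip.lamMinPos_mul_le_inner (h : IsGossip G What) {x : Stacked n d}
    (hx : x ∈ LinearMap.range (commOp d What)) :
    lamMinPos d What * ‖x‖ ^ 2 ≤ ⟪commOp d What x, x⟫ :=
  sInf_eigenvalues_mul_le_inner h.isSymmetric h.inner_nonneg hx

/-! ### The penalty -/

variable {lam : ℝ}

/-- Exact second-order expansion of a quadratic; convexity and strong convexity on the range both
read off its last term. -/
theorem IsGossip.penalty_sub (h : IsGossip G What) (x y : Stacked n d) :
    penalty lam What y - penalty lam What x =
      ⟪lam • commOp d What x, y - x⟫ + lam / 2 * ⟪commOp d What (y - x), y - x⟫ := by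
  obtain ⟨u, rfl⟩ : ∃ u, y = x + u := ⟨y - x, by abel⟩
  have h1 : ⟪x, commOp d What u⟫ = ⟪commOp d What x, u⟫ := (h.isSymmetric x u).symm
  simp only [penalty, add_sub_cancel_left, map_add, inner_add_left, inner_add_right,
    inner_smul_left, RCLike.conj_to_real, h1, real_inner_comm (commOp d What x) u,
    real_inner_comm (commOp d What u) u]
  ring

theorem IsGossip.hasGradientAt_penalty (h : IsGossip G What) (x : Stacked n d) :
    HasGradientAt (penalty lam What) (lam • commOp d What x) x :=
  hasGradientAt_quadratic h.isSymmetric x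

theorem IsGossip.gradient_penalty (h : IsGossip G What) (x : Stacked n d) :
    ∇ (penalty lam What) x = lam • commOp d What x :=
  (h.hasGradientAt_penalty x).gradient

theorem IsGossip.gradient_penalty_lipschitz (h : IsGossip G What) (hlam : 0 < lam)
    (x y : Stacked n d) :
    ‖∇ (penalty lam What) y - ∇ (penalty lam What) x‖ ≤ lam * lamMax d What * ‖y - x‖ := by
  rw [h.gradient_penalty, h.gradient_penalty, ← smul_sub, ← map_sub, norm_smul,
    Real.norm_of_nonneg hlam.le, mul_assoc]
  exact mul_le_mul_of_nonneg_left (h.norm_commOp_le _) hlam.le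

theorem IsGossip.penalty_convex (h : IsGossip G What) (hlam : 0 < lam) (x y : Stacked n d) :
    ⟪∇ (penalty lam What) x, y - x⟫ ≤ penalty lam What y - penalty lam What x := by
  rw [h.penalty_sub, h.gradient_penalty]
  have := h.inner_nonneg (y - x)
  have : 0 ≤ lam / 2 * ⟪commOp d What (y - x), y - x⟫ := by positivity
  linarith

theorem IsGossip.penalty_strong_on_range (h : IsGossip G What) (hlam : 0 < lam)
    (x y : Stacked n d) (hxy : y - x ∈ LinearMap.range (commOp d What)) :
    ⟪∇ (penalty lam What) x, y - x⟫ + lam * lamMinPos d What / 2 * ‖y - x‖ ^ 2 ≤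
      penalty lam What y - penalty lam What x := by
  rw [h.penalty_sub, h.gradient_penalty]
  have := mul_le_mul_of_nonneg_left (h.lamMinPos_mul_le_inner hxy) (half_pos hlam).le
  linarith

end Gossip

/-! ### The loss -/

section Loss

variable {n d : ℕ} {L μ : ℝ} {f : Fin n → EuclideanSpace ℝ (Fin d) → ℝ}

theorem hasGradientAt_loss (hf : ∀ k, SmoothStrong L μ (f k)) (x : Stacked n d) :
    HasGradientAt (loss f) ((1 / (n : ℝ)) • WithLp.toLp 2 fun k => ∇ (f k) (x k)) x := by
  have h1 : ∀ k, HasFDerivAt (fun x : Stacked n d => f k (x k))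
      ((innerSL ℝ (∇ (f k) (x k))).comp (PiLp.proj 2 (fun _ : Fin n => EuclideanSpace ℝ (Fin d)) k))
      x := fun k =>
    (hasFDerivAt_innerSL_gradient (hf k).diff (x k)).comp x (PiLp.hasFDerivAt_apply 2 x k)
  have h2 := (HasFDerivAt.fun_sum fun k (_ : k ∈ Finset.univ) => h1 k).const_mul (1 / (n : ℝ))
  rw [hasGradientAt_iff_hasFDerivAt]
  refine h2.congr_fderiv ?_
  ext v
  simp [PiLp.inner_apply]

theorem gradient_loss (hf : ∀ k, SmoothStrong L μ (f k)) (x : Stacked n d) :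
    ∇ (loss f) x = (1 / (n : ℝ)) • WithLp.toLp 2 fun k => ∇ (f k) (x k) :=
  (hasGradientAt_loss hf x).gradient

theorem gradient_loss_lipschitz (hf : ∀ k, SmoothStrong L μ (f k)) (hL : 0 ≤ L)
    (x y : Stacked n d) : ‖∇ (loss f) y - ∇ (loss f) x‖ ≤ L / n * ‖y - x‖ := by
  rw [gradient_loss hf, gradient_loss hf, ← smul_sub, norm_smul, Real.norm_of_nonneg (by positivity)]
  have h1 : ‖(WithLp.toLp 2 fun k => ∇ (f k) (y k)) - WithLp.toLp 2 fun k => ∇ (f k) (x k)‖ ≤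
      L * ‖y - x‖ := by
    refine (sq_le_sq₀ (norm_nonneg _) (by positivity)).1 ?_
    rw [mul_pow, PiLp.norm_sq_eq_of_L2, PiLp.norm_sq_eq_of_L2, Finset.mul_sum]
    refine Finset.sum_le_sum fun k _ => ?_
    rw [← mul_pow]
    exact pow_le_pow_left₀ (norm_nonneg _) ((hf k).smooth (x k) (y k)) 2
  calc 1 / (n : ℝ) * _ ≤ 1 / (n : ℝ) * (L * ‖y - x‖) := by gcongr
    _ = L / n * ‖y - x‖ := by ring

theorem loss_strong (hf : ∀ k, SmoothStrong L μ (f k)) (x y : Stacked n d) :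
    ⟪∇ (loss f) x, y - x⟫ + μ / n / 2 * ‖y - x‖ ^ 2 ≤ loss f y - loss f x := by
  rw [gradient_loss hf, inner_smul_left, PiLp.inner_apply, PiLp.norm_sq_eq_of_L2]
  have h1 := Finset.sum_le_sum fun k (_ : k ∈ Finset.univ) => (hf k).strong (x k) (y k)
  rw [Finset.sum_add_distrib, Finset.sum_sub_distrib, ← Finset.mul_sum] at h1
  have h2 := mul_le_mul_of_nonneg_left h1 (show 0 ≤ 1 / (n : ℝ) by positivity)
  simp only [loss, RCLike.conj_to_real]
  refine le_trans (le_of_eq ?_) (h2.trans (le_of_eq ?_))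
  · simp only [WithLp.ofLp_sub, Pi.sub_apply]; ring
  · ring

/-- Strong convexity between 0 and a unit vector e, in both orders, gives μ ≤ ⟪∇φ(e) - ∇φ(0), e⟫ ≤
L; a unit vector needs d > 0. -/
theorem SmoothStrong.le {φ : EuclideanSpace ℝ (Fin d) → ℝ} (h : SmoothStrong L μ φ) (hd : 0 < d) :
    μ ≤ L := by
  let e : EuclideanSpace ℝ (Fin d) := EuclideanSpace.single ⟨0, hd⟩ 1
  have he : ‖e‖ = 1 := by simp [e]
  have h1 := h.strong 0 e
  have h2 := h.strong e 0
  have h3 := h.smooth 0 e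
  have h4 := real_inner_le_norm (∇ φ e - ∇ φ 0) e
  simp only [sub_zero, zero_sub, inner_neg_right, norm_neg, he, inner_sub_left] at h1 h2 h3 h4
  linarith

end Loss

/-! ### Choice of the numbers of restarts and inner steps, and the resulting counts -/

open Filter Topology in
theorem tendsto_log_const_div {c : ℝ} (hc : 0 < c) :
    Tendsto (fun ε : ℝ => Real.log (c / ε)) (𝓝[>] 0) atTop := by
  simp only [div_eq_mul_inv]
  exact Real.tendsto_log_atTop.comp (tendsto_inv_nhdsGT_zero.const_mul_atTop hc)

/-- Take s = ⌈log(R²/ε) + |log μ|⌉ and use 1/4 ≤ 1/e. The factor 2 in the bound on `s` absorbs |log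
μ| and the rounding. -/
theorem exists_restart_number {μ R ε : ℝ} (hμ : 0 < μ) (hR : 0 < R) (hε : 0 < ε)
    (h : |Real.log μ| + 1 ≤ Real.log (R ^ 2 / ε)) :
    ∃ s : ℕ, 1 ≤ s ∧ (s : ℝ) ≤ 2 * Real.log (R ^ 2 / ε) ∧
      μ / 2 * ((1 / 4) ^ s * R ^ 2) + ε / 6 ≤ ε := by
  set l := Real.log (R ^ 2 / ε) with hl
  have habs := abs_nonneg (Real.log μ)
  have hle := Nat.le_ceil (l + |Real.log μ|)
  refine ⟨⌈l + |Real.log μ|⌉₊, Nat.one_le_ceil_iff.2 (by linarith), ?_, ?_⟩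
  · have := Nat.ceil_lt_add_one (show 0 ≤ l + |Real.log μ| by linarith)
    linarith
  · generalize ⌈l + |Real.log μ|⌉₊ = s at hle
    have h1 : (1 / 4 : ℝ) ≤ Real.exp (-1) := by
      rw [Real.exp_neg, one_div]
      exact inv_anti₀ (Real.exp_pos 1) (by linarith [Real.exp_one_lt_three])
    have h2 : (1 / 4 : ℝ) ^ s ≤ ε / R ^ 2 / μ := by
      calc (1 / 4 : ℝ) ^ s ≤ Real.exp (-1) ^ s := pow_le_pow_left₀ (by norm_num) h1 s
        _ = Real.exp (-s) := by rw [← Real.exp_nat_mul]; ring_nf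
        _ ≤ Real.exp (-l - Real.log μ) :=
            Real.exp_le_exp.2 (by linarith [le_abs_self (Real.log μ)])
        _ = ε / R ^ 2 / μ := by
            rw [Real.exp_sub, Real.exp_neg, Real.exp_log hμ, hl, Real.exp_log (by positivity),
              inv_div]
    have h3 : μ / 2 * ((1 / 4) ^ s * R ^ 2) ≤ μ / 2 * (ε / R ^ 2 / μ * R ^ 2) := by gcongr
    have h4 : μ / 2 * (ε / R ^ 2 / μ * R ^ 2) = ε / 2 := by field_simp
    linarith

/-- The same device, with a rate √(mi/Li) per step. D² + 1 replaces D² to keep the logarithm of the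
constant meaningful when D = 0. -/
theorem exists_inner_number {Li mi D δ : ℝ} (hmi : 0 < mi) (hle : mi ≤ Li) (hδ : 0 < δ)
    (h : |Real.log (4 * (Li / mi) * (D ^ 2 + 1))| + 2 ≤ Real.log (1 / δ)) :
    ∃ T : ℕ, (T : ℝ) + 1 ≤ 2 * √(Li / mi) * Real.log (1 / δ) ∧
      4 * (Li / mi) * Real.exp (-(√(mi / Li) * T)) * D ^ 2 ≤ δ := by
  have hLi : 0 < Li := hmi.trans_le hle
  set c := 4 * (Li / mi) * (D ^ 2 + 1) with hc
  have hc0 : 0 < c := by positivity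
  set l := Real.log (1 / δ) with hl
  have hκ : 1 ≤ √(Li / mi) := Real.one_le_sqrt.2 ((one_le_div hmi).2 hle)
  have hinv : √(mi / Li) * √(Li / mi) = 1 := by
    rw [← Real.sqrt_mul (by positivity), div_mul_div_comm, mul_comm mi, div_self (by positivity),
      Real.sqrt_one]
  have habs := le_abs_self (Real.log c)
  have habs' := neg_abs_le (Real.log c)
  have hle := Nat.le_ceil (√(Li / mi) * (Real.log c + l))
  refine ⟨⌈√(Li / mi) * (Real.log c + l)⌉₊, ?_, ?_⟩
  · have := Nat.ceil_lt_add_one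
      (show 0 ≤ √(Li / mi) * (Real.log c + l) from mul_nonneg (by positivity) (by linarith))
    nlinarith
  · generalize ⌈√(Li / mi) * (Real.log c + l)⌉₊ = T at hle
    have h1 : Real.log c + l ≤ √(mi / Li) * T := by
      calc Real.log c + l = √(mi / Li) * (√(Li / mi) * (Real.log c + l)) := by
            rw [← mul_assoc, hinv, one_mul]
        _ ≤ _ := by gcongr
    have h2 : Real.exp (-(√(mi / Li) * T)) ≤ δ / c := by
      calc Real.exp (-(√(mi / Li) * T)) ≤ Real.exp (-l - Real.log c) :=
            Real.exp_le_exp.2 (by linarith)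
        _ = δ / c := by
            rw [Real.exp_sub, Real.exp_neg, Real.exp_log hc0, hl, Real.exp_log (by positivity),
              one_div, inv_inv]
    calc 4 * (Li / mi) * Real.exp (-(√(mi / Li) * T)) * D ^ 2
        ≤ 4 * (Li / mi) * (δ / c) * (D ^ 2 + 1) := by gcongr; linarith
      _ = δ := by rw [hc]; field_simp

/-- Numbers of restarts and of inner steps with which the restarted method works, for a composite
problem and all small accuracies. -/
theorem CompositeProblem.exists_schedule {E : Type} [NormedAddCommGroup E] [InnerProductSpace ℝ E]
    [CompleteSpace E] [FiniteDimensional ℝ E] {φ ψ : E → ℝ} {H Lψ μ : ℝ} {xs : E}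
    (P : CompositeProblem φ ψ H Lψ μ xs) {K : Submodule ℝ E} {mψ : ℝ} (hm : 0 ≤ mψ)
    (hmL : mψ ≤ Lψ) (hK : ∀ v, ∇ ψ v ∈ K)
    (hstrong : ∀ u v, u - v ∈ K → ⟪∇ ψ v, u - v⟫ + mψ / 2 * ‖u - v‖ ^ 2 ≤ ψ u - ψ v)
    {z₀ : E} (hz₀ : z₀ ≠ xs) {c θ : ℝ} (hc : Lψ + H ≤ c) (hθ : 0 < θ) :
    ∃ ε₀ : ℝ, 0 < ε₀ ∧ ∀ ε : ℝ, 0 < ε → ε ≤ ε₀ →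
      ∃ s T : ℕ, 1 ≤ s ∧ (s : ℝ) ≤ 2 * Real.log (‖z₀ - xs‖ ^ 2 / ε) ∧
        (T : ℝ) + 1 ≤ 2 * √((H + Lψ) / (H + mψ)) *
          Real.log (1 / (ε * μ / (864 ^ 2 * c ^ 2))) ∧
        1 ≤ Real.log (1 / (ε * μ / (864 ^ 2 * c ^ 2))) ∧
        1 ≤ θ * Real.log (1 / (ε * μ / (864 ^ 2 * c ^ 2))) ∧
        (∀ out, IsRAMRun φ ψ H (ε * μ / (864 ^ 2 * c ^ 2)) (restartLength H μ) s z₀ out →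
          φ out + ψ out - (φ xs + ψ xs) ≤ ε) ∧
        IsRAMRun φ ψ H (ε * μ / (864 ^ 2 * c ^ 2)) (restartLength H μ) s z₀
          ((amIter (∇ φ) (∇ ψ) H (innerSolver (∇ φ) (∇ ψ) H (H + Lψ) (H + mψ) T)
            (restartLength H μ))^[s] z₀) := by
  have hH := P.H_pos
  have hμ := P.μ_pos
  have hL := P.Lψ_nonneg
  have hc0 : 0 < c := by linarith
  have hR : 0 < ‖z₀ - xs‖ := norm_pos_iff.2 (sub_ne_zero.2 hz₀)
  -- This bound on the initial inner error does not involve ε, since neither the restart length nor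
  -- the radius does.
  set D := (3 / 2 * Lψ * radiusSeq H Lψ (‖z₀ - xs‖ + 1) (restartLength H μ) + ‖∇ ψ xs‖) / H
    with hD
  have hδe : ∀ ε : ℝ, 1 / (ε * μ / (864 ^ 2 * c ^ 2)) = 864 ^ 2 * c ^ 2 / μ / ε := by
    intro ε
    rw [one_div_div, div_div, mul_comm ε]
  have hev : ∀ᶠ ε : ℝ in nhdsWithin 0 (Set.Ioi 0),
      |Real.log μ| + 1 ≤ Real.log (‖z₀ - xs‖ ^ 2 / ε) ∧
      max (max 1 (1 / θ)) (|Real.log (4 * ((H + Lψ) / (H + mψ)) * (D ^ 2 + 1))| + 2) ≤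
        Real.log (864 ^ 2 * c ^ 2 / μ / ε) ∧ ε ≤ μ :=
    ((tendsto_log_const_div (by positivity)).eventually_ge_atTop _).and
      (((tendsto_log_const_div (by positivity)).eventually_ge_atTop _).and
        (nhdsWithin_le_nhds (Iic_mem_nhds hμ)))
  obtain ⟨ε₀, hε₀, hsub⟩ := mem_nhdsGT_iff_exists_Ioc_subset.1 hev
  refine ⟨ε₀, hε₀, fun ε hε hεε₀ => ?_⟩
  obtain ⟨h1, h2, h3⟩ := hsub ⟨hε, hεε₀⟩
  rw [← hδe, max_le_iff, max_le_iff] at h2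
  obtain ⟨⟨h4, h5⟩, h6⟩ := h2
  set δ := ε * μ / (864 ^ 2 * c ^ 2) with hδ
  have hδ0 : 0 < δ := by positivity
  have hδ1 : δ ≤ 1 := by
    by_contra hcon
    have : Real.log (1 / δ) ≤ 0 :=
      Real.log_nonpos (by positivity) ((div_le_one hδ0).2 (not_le.1 hcon).le)
    linarith
  have hδε : (Lψ + H) ^ 2 * δ ≤ ε * μ / 864 ^ 2 := by
    calc (Lψ + H) ^ 2 * δ ≤ c ^ 2 * δ := by gcongr
      _ = ε * μ / 864 ^ 2 := by rw [hδ]; field_simp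
  obtain ⟨s, hs1, hs2, hs3⟩ := exists_restart_number hμ hR hε h1
  obtain ⟨T, hT1, hT2⟩ := exists_inner_number (D := D) (show 0 < H + mψ by positivity)
    (show H + mψ ≤ H + Lψ by linarith) hδ0 h6
  refine ⟨s, T, hs1, hs2, hT1, h4, by rwa [div_le_iff₀' hθ] at h5, fun out hout => ?_, ?_⟩
  · exact (P.restarted_gap_le hε.le hδ0.le hδε hs1 hout).trans hs3
  · exact P.iterate_amIter_isRAMRun hε.le h3 hδ0.le hδ1 hδε
      (fun w hw => P.innerSolver_solvesAux hm hmL hK hstrong hT2 hw) s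

theorem restartLength_two_mul_le {m μ : ℝ} : (restartLength (2 * m) μ : ℝ) ≤ 8 * √(m / μ) + 1 := by
  have e : 2 * √(8 * (2 * m) / μ) = 8 * √(m / μ) := by
    have h1 : 8 * (2 * m) / μ = 4 ^ 2 * (m / μ) := by ring
    rw [h1, Real.sqrt_mul (by norm_num), Real.sqrt_sq (by norm_num)]; ring
  have h0 : 0 ≤ 8 * √(m / μ) := by positivity
  rw [restartLength, e, Nat.cast_max]
  refine max_le (Nat.ceil_lt_add_one h0).le ?_
  push_cast; linarith

/-- `√κ √(a / μ) ≤ 2 √(b / μ)` for the condition number `κ` of the auxiliary problem, in which `a`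
is the smaller and `b` the larger one of the two smoothness constants. -/
theorem sqrt_condition_mul_le {a b m μ : ℝ} (ha : 0 < a) (hab : a ≤ b) (hm : 0 ≤ m) (hμ : 0 < μ) :
    √((2 * a + b) / (2 * a + m)) * √(a / μ) ≤ 2 * √(b / μ) := by
  have hb : 0 < b := ha.trans_le hab
  have e : 2 * √(b / μ) = √(4 * (b / μ)) := by
    rw [Real.sqrt_mul (by norm_num), show (4 : ℝ) = 2 ^ 2 by norm_num,
      Real.sqrt_sq (by norm_num)]
  rw [← Real.sqrt_mul (by positivity), e]
  refine Real.sqrt_le_sqrt ?_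
  have h1 : (2 * a + b) / (2 * a + m) * a ≤ 4 * b := by
    rw [div_mul_eq_mul_div, div_le_iff₀ (by positivity)]
    nlinarith [mul_nonneg hb.le hm, mul_pos ha hb]
  calc (2 * a + b) / (2 * a + m) * (a / μ) = (2 * a + b) / (2 * a + m) * a / μ := by ring
    _ ≤ 4 * b / μ := by gcongr
    _ = _ := by ring

/-- Here θ ≥ 1 absorbs the rounding of N, giving N ≤ 9θ. The inner condition number is bounded in
two ways, one for each entry of the minimum. -/
theorem penalty_inner_complexity {s N T θ l₁ l₂ Lf Lp μf μp : ℝ} (hμf : 0 < μf) (hμL : μf ≤ Lf)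
    (hle : Lf ≤ Lp) (hμp : 0 < μp) (hμpL : μp ≤ Lp) (hθ : θ = √(Lf / μf)) (hs0 : 0 ≤ s)
    (hN0 : 0 ≤ N) (hs : s ≤ 2 * l₁) (hN : N ≤ 8 * θ + 1)
    (hT : T + 1 ≤ 2 * √((2 * Lf + Lp) / (2 * Lf + μp)) * l₂) (hl₂ : 1 ≤ l₂) :
    s * (N * (T + 1)) ≤
        72 * (min √(Lp / μf) √(Lf / μf * (Lp / μp)) * l₁ * l₂) ∧
      s * (N * 2) ≤ 72 * (θ * l₁ * l₂) := by
  have hLf : 0 < Lf := hμf.trans_le hμL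
  have hLp : 0 < Lp := hLf.trans_le hle
  have hl₁ : 0 ≤ l₁ := by linarith
  have hθ1 : 1 ≤ θ := by rw [hθ]; exact Real.one_le_sqrt.2 ((one_le_div hμf).2 hμL)
  have hN' : N ≤ 9 * θ := by linarith
  set κ := √((2 * Lf + Lp) / (2 * Lf + μp)) with hκ
  have hκ0 : 0 ≤ κ := Real.sqrt_nonneg _
  have hmin : κ * θ ≤ 2 * min √(Lp / μf) √(Lf / μf * (Lp / μp)) := by
    rw [mul_min_of_nonneg _ _ (by norm_num), hθ]
    refine le_min (sqrt_condition_mul_le hLf hle hμp.le hμf) ?_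
    have h1 : κ ≤ √(Lp / μp) := by
      refine Real.sqrt_le_sqrt ?_
      rw [div_le_div_iff₀ (by positivity) hμp]
      nlinarith
    rw [Real.sqrt_mul (by positivity)]
    have h2 := mul_le_mul_of_nonneg_right h1 (Real.sqrt_nonneg (Lf / μf))
    have h3 : 0 ≤ √(Lf / μf) * √(Lp / μp) := by positivity
    linarith
  constructor
  · calc s * (N * (T + 1)) ≤ s * (N * (2 * κ * l₂)) := by gcongr
      _ ≤ 2 * l₁ * (9 * θ * (2 * κ * l₂)) := by gcongr
      _ = 36 * (κ * θ * l₁ * l₂) := by ring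
      _ ≤ 36 * (2 * min √(Lp / μf) √(Lf / μf * (Lp / μp)) * l₁ * l₂) := by gcongr
      _ = _ := by ring
  · calc s * (N * 2) ≤ 2 * l₁ * (9 * θ * 2) := by gcongr
      _ = 36 * (θ * l₁ * 1) := by ring
      _ ≤ 72 * (θ * l₁ * l₂) := by gcongr; norm_num

/-- Now θ may be below 1, so N ≤ 8θ + 1 is not O(θ). The extra 1 is paid by θ l₂ ≥ 1 in the first
count and by κ ≤ 2√(Lf/μf) in the second. -/
theorem loss_inner_complexity {s N T θ l₁ l₂ Lf Lp μf μp : ℝ} (hμf : 0 < μf) (hμL : μf ≤ Lf)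
    (hLp : 0 < Lp) (hle : Lp ≤ Lf) (hμp : 0 < μp) (hμpL : μp ≤ Lp) (hθ : θ = √(Lp / μf))
    (hs0 : 0 ≤ s) (hN0 : 0 ≤ N) (hs : s ≤ 2 * l₁) (hN : N ≤ 8 * θ + 1)
    (hT : T + 1 ≤ 2 * √((2 * Lp + Lf) / (2 * Lp + μf)) * l₂) (hl₂ : 1 ≤ l₂)
    (hθl : 1 ≤ θ * l₂) :
    s * (N * 2) ≤ 72 * (min √(Lp / μf) √(Lf / μf * (Lp / μp)) * l₁ * l₂) ∧
      s * (N * (T + 1)) ≤ 72 * (√(Lf / μf) * l₁ * l₂) := by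
  have hLf : 0 < Lf := hμf.trans_le hμL
  have hl₁ : 0 ≤ l₁ := by linarith
  have hθ0 : 0 ≤ θ := by rw [hθ]; exact Real.sqrt_nonneg _
  set κ := √((2 * Lp + Lf) / (2 * Lp + μf)) with hκ
  have hκ0 : 0 ≤ κ := Real.sqrt_nonneg _
  have hmin : θ ≤ min √(Lp / μf) √(Lf / μf * (Lp / μp)) := by
    rw [hθ]
    refine le_min le_rfl (Real.sqrt_le_sqrt ?_)
    calc Lp / μf ≤ Lf / μf * 1 := by rw [mul_one]; gcongr
      _ ≤ Lf / μf * (Lp / μp) := by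
        gcongr
        exact (one_le_div hμp).2 hμpL
  have hκθ : κ * θ ≤ 2 * √(Lf / μf) := by
    rw [hθ]; exact sqrt_condition_mul_le hLp hle hμf.le hμf
  have hκ1 : κ ≤ 2 * √(Lf / μf) := by
    have e : 2 * √(Lf / μf) = √(4 * (Lf / μf)) := by
      rw [Real.sqrt_mul (by norm_num), show (4 : ℝ) = 2 ^ 2 by norm_num,
        Real.sqrt_sq (by norm_num)]
    rw [e]
    refine Real.sqrt_le_sqrt ?_
    rw [← mul_div_assoc, div_le_div_iff₀ (by positivity) hμf]
    nlinarith [mul_pos hLf hμf, mul_pos hLf hLp]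
  constructor
  · calc s * (N * 2) ≤ 2 * l₁ * ((8 * θ + 1) * 2) := by gcongr
      _ ≤ 2 * l₁ * ((8 * (θ * l₂) + θ * l₂) * 2) := by
          gcongr
          nlinarith
      _ = 36 * (θ * l₁ * l₂) := by ring
      _ ≤ 72 * (min √(Lp / μf) √(Lf / μf * (Lp / μp)) * l₁ * l₂) := by gcongr; norm_num
  · calc s * (N * (T + 1)) ≤ s * (N * (2 * κ * l₂)) := by gcongr
      _ ≤ 2 * l₁ * ((8 * θ + 1) * (2 * κ * l₂)) := by gcongr
      _ = 4 * ((8 * (κ * θ) + κ) * l₁ * l₂) := by ring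
      _ ≤ 4 * ((8 * (2 * √(Lf / μf)) + 2 * √(Lf / μf)) * l₁ * l₂) := by gcongr
      _ = 72 * (√(Lf / μf) * l₁ * l₂) := by ring

/-! ### The penalized problem as a composite problem -/

section Penalized

variable {n d : ℕ} {G : SimpleGraph (Fin n)} {What : Matrix (Fin n) (Fin n) ℝ} {lam L μ : ℝ}
  {f : Fin n → EuclideanSpace ℝ (Fin d) → ℝ} {xs : Stacked n d}

theorem computes_lossGrad (hf : ∀ k, SmoothStrong L μ (f k)) :
    Computes (commOp d What) (fun x => WithLp.toLp 2 fun k => ∇ (f k) (x k)) (lossGrad n)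
      (∇ (loss f)) 0 1 where
  val x := (gradient_loss hf x).symm
  comms _ := rfl
  grads _ := rfl

theorem computes_penaltyGrad (h : IsGossip G What)
    (D : Stacked n d → Stacked n d) :
    Computes (commOp d What) D (penaltyGrad lam) (∇ (penalty lam What)) 1 0 where
  val x := (h.gradient_penalty x).symm
  comms _ := rfl
  grads _ := rfl

theorem objective_strong (h : IsGossip G What) (hlam : 0 < lam)
    (hf : ∀ k, SmoothStrong L μ (f k)) (x y : Stacked n d) :
    ⟪∇ (loss f) x + ∇ (penalty lam What) x, y - x⟫ + μ / n / 2 * ‖y - x‖ ^ 2 ≤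
      loss f y + penalty lam What y - (loss f x + penalty lam What x) := by
  rw [inner_add_left]
  linarith [loss_strong hf x y, h.penalty_convex hlam x y]

theorem objective_stationary (h : IsGossip G What) (hf : ∀ k, SmoothStrong L μ (f k))
    (hxs : ∀ x, objective f lam What xs ≤ objective f lam What x) :
    ∇ (loss f) xs + ∇ (penalty lam What) xs = 0 := by
  rw [← gradient_eq_zero_of_forall_le hxs]
  refine (HasGradientAt.gradient ?_).symm
  rw [hasGradientAt_iff_hasFDerivAt, map_add]
  exact HasFDerivAt.add
    (hasGradientAt_iff_hasFDerivAt.1 (hasGradientAt_loss hf xs).differentiableAt.hasGradientAt)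
    (hasGradientAt_iff_hasFDerivAt.1 (h.hasGradientAt_penalty xs).differentiableAt.hasGradientAt)

theorem compositeProblem_loss_penalty (h : IsGossip G What) (hn : 2 ≤ n) (hd : 0 < d)
    (hlam : 0 < lam) (hL : 0 < L) (hμ : 0 < μ) (hf : ∀ k, SmoothStrong L μ (f k))
    (hxs : ∀ x, objective f lam What xs ≤ objective f lam What x) :
    CompositeProblem (loss f) (penalty lam What) (2 * (L / n)) (lam * lamMax d What) (μ / n) xs :=
  have hn' : (0 : ℝ) < n := by exact_mod_cast (by omega : 0 < n)
  { H_pos := by positivity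
    μ_pos := by positivity
    Lψ_nonneg := mul_nonneg hlam.le
      ((h.lamMinPos_pos hn hd).le.trans (h.lamMinPos_le_lamMax hn hd))
    diffφ := fun x => (hasGradientAt_loss hf x).differentiableAt
    lipφ := fun x y => by
      rw [mul_div_cancel_left₀ _ (two_ne_zero' ℝ)]; exact gradient_loss_lipschitz hf hL.le x y
    diffψ := fun x => (h.hasGradientAt_penalty x).differentiableAt
    lipψ := h.gradient_penalty_lipschitz hlam
    convψ := h.penalty_convex hlam
    strong := objective_strong h hlam hf
    stationary := objective_stationary h hf hxs }

theorem compositeProblem_penalty_loss (h : IsGossip G What) (hn : 2 ≤ n) (hd : 0 < d)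
    (hlam : 0 < lam) (hL : 0 < L) (hμ : 0 < μ) (hf : ∀ k, SmoothStrong L μ (f k))
    (hxs : ∀ x, objective f lam What xs ≤ objective f lam What x) :
    CompositeProblem (penalty lam What) (loss f) (2 * (lam * lamMax d What)) (L / n) (μ / n) xs :=
  have hn' : (0 : ℝ) < n := by exact_mod_cast (by omega : 0 < n)
  { H_pos := mul_pos two_pos (mul_pos hlam
      ((h.lamMinPos_pos hn hd).trans_le (h.lamMinPos_le_lamMax hn hd)))
    μ_pos := by positivity
    Lψ_nonneg := by positivity
    diffφ := fun x => (h.hasGradientAt_penalty x).differentiableAt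
    lipφ := fun x y => by
      rw [mul_div_cancel_left₀ _ (two_ne_zero' ℝ)]; exact h.gradient_penalty_lipschitz hlam x y
    diffψ := fun x => (hasGradientAt_loss hf x).differentiableAt
    lipψ := gradient_loss_lipschitz hf hL.le
    convψ := fun x y => by
      have : 0 ≤ μ / n / 2 * ‖y - x‖ ^ 2 := by positivity
      linarith [loss_strong hf x y]
    strong := fun x y => by
      have := objective_strong h hlam hf x y
      rw [add_comm (∇ (loss f) x)] at this
      linarith
    stationary := by rw [add_comm]; exact objective_stationary h hf hxs }

end Penalized

end PFL

theorem theorem3 :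
    ∃ C : ℝ, 0 < C ∧
      ∀ (n d : ℕ), 2 ≤ n →
      ∀ (G : SimpleGraph (Fin n)) (What : Matrix (Fin n) (Fin n) ℝ), IsGossip G What →
      ∀ (lam L μ : ℝ), 0 < lam → 0 < L → 0 < μ →
      ∀ f : Fin n → EuclideanSpace ℝ (Fin d) → ℝ, (∀ k, SmoothStrong L μ (f k)) →
      ∀ xStar : Stacked n d, (∀ x, objective f lam What xStar ≤ objective f lam What x) →
      ∀ z₀ : Stacked n d, z₀ ≠ xStar →
      ∃ ε₀ : ℝ, 0 < ε₀ ∧ ∀ ε : ℝ, 0 < ε → ε ≤ ε₀ →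
        let F := objective f lam What
        let Lf := L / n
        let μf := μ / n
        let Lp := lam * lamMax d What
        let μp := lam * lamMinPos d What
        let χ := lamMax d What / lamMinPos d What
        let H := paramH Lf Lp
        let N := restartLength H μf
        let δ := auxAccuracy ε μf Lf Lp H
        let φ := linearizedPart f lam What Lf Lp
        let ψ := compositePart f lam What Lf Lp
        ∃ s T : ℕ, 1 ≤ s ∧
          -- auxiliary problems solved with accuracy `δ`, by whatever means, give an `ε`-solution
          (∀ out : Stacked n d, IsRAMRun φ ψ H δ N s z₀ out → F out - F xStar ≤ ε) ∧
          -- the method with `T` inner steps solves all of them with this accuracy,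
          -- so that it returns an `ε`-solution
          IsRAMRun φ ψ H δ N s z₀ (execute f What lam Lf μf Lp μp T s z₀).val ∧
          F (execute f What lam Lf μf Lp μp T s z₀).val - F xStar ≤ ε ∧
          -- communications
          ((execute f What lam Lf μf Lp μp T s z₀).comms : ℝ) ≤
            C * (min √(lam * lamMax d What / μf) √(L / μ * χ) *
              Real.log (‖z₀ - xStar‖ ^ 2 / ε) * Real.log (1 / δ)) ∧
          -- local gradient calls
          ((execute f What lam Lf μf Lp μp T s z₀).grads : ℝ) ≤
            C * (√(L / μ) * Real.log (‖z₀ - xStar‖ ^ 2 / ε) * Real.log (1 / δ)) := by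
  refine ⟨72, by norm_num, ?_⟩
  intro n d hn G What hG lam L μ hlam hL hμ f hf xStar hxs z₀ hz₀
  -- For d = 0 the space is a single point, which z₀ ≠ xStar excludes.
  have hd : 0 < d := by
    rcases Nat.eq_zero_or_pos d with rfl | hd
    · exact absurd (by ext k a; exact a.elim0) hz₀
    · exact hd
  have hn' : (0 : ℝ) < n := by exact_mod_cast (by omega : 0 < n)
  have hμL : μ / n ≤ L / n := by
    gcongr
    exact (hf ⟨0, by omega⟩).le hd
  have hμf : 0 < μ / n := by positivity
  have hmin := hG.lamMinPos_pos hn hd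
  have hminmax := hG.lamMinPos_le_lamMax hn hd
  have hμp : 0 < lam * lamMinPos d What := by positivity
  have hμpL : lam * lamMinPos d What ≤ lam * lamMax d What := by gcongr
  have hLp : 0 < lam * lamMax d What := hμp.trans_le hμpL
  have hLf : 0 < L / n := by positivity
  have hχ : lamMax d What / lamMinPos d What = lam * lamMax d What / (lam * lamMinPos d What) := by
    rw [mul_div_mul_left _ _ hlam.ne']
  have hκ : L / μ = L / n / (μ / n) := by rw [div_div_div_cancel_right₀ hn'.ne']
  have hl := computes_lossGrad (What := What) hf
  have hp := computes_penaltyGrad (lam := lam) hG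
    (fun x : Stacked n d => WithLp.toLp 2 fun k => ∇ (f k) (x k))
  rw [hχ, hκ]
  unfold linearizedPart compositePart execute method
  rcases le_or_gt (L / n) (lam * lamMax d What) with hle | hlt
  · have P := compositeProblem_loss_penalty hG hn hd hlam hL hμ hf hxs
    -- The penalty gradient takes values in the range of W, where the penalty is strongly convex. No
    -- smallness relative to θ is needed here, hence θ = 1.
    obtain ⟨ε₀, hε₀, H⟩ := P.exists_schedule (K := LinearMap.range (commOp d What)) hμp.le hμpL
      (fun v => by
        rw [hG.gradient_penalty]
        exact Submodule.smul_mem _ _ (LinearMap.mem_range_self _ v))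
      (fun u v huv => hG.penalty_strong_on_range hlam v u huv) hz₀
      (c := L / n + lam * lamMax d What + 2 * (L / n)) (θ := 1) (by linarith) one_pos
    refine ⟨ε₀, hε₀, fun ε hε hεε₀ => ?_⟩
    obtain ⟨s, T, hs1, hs, hT, hl₂, -, hany, hrun⟩ := H ε hε hεε₀
    simp only [if_pos hle, paramH, min_eq_left hle, auxAccuracy]
    have hc := hl.ramProg hp (2 * (L / n)) (2 * (L / n) + lam * lamMax d What)
      (2 * (L / n) + lam * lamMinPos d What) T (restartLength (2 * (L / n)) (μ / n)) s
    refine ⟨s, T, hs1, hany, ?_, ?_, ?_⟩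
    · rw [hc.val]; exact hrun
    · rw [hc.val]; exact hany _ hrun
    · rw [hc.comms, hc.grads]
      have := penalty_inner_complexity hμf hμL hle hμp hμpL rfl (Nat.cast_nonneg s)
        (Nat.cast_nonneg (restartLength (2 * (L / n)) (μ / n))) hs restartLength_two_mul_le hT hl₂
      push_cast
      simpa using this
  · have P := compositeProblem_penalty_loss hG hn hd hlam hL hμ hf hxs
    -- The loss is strongly convex in all directions, so K is the whole space. With this θ, ε₀ also
    -- guarantees θ log(1/δ) ≥ 1, which compensates for a small L_p/μ_f.
    obtain ⟨ε₀, hε₀, H⟩ := P.exists_schedule (K := ⊤) hμf.le hμL (fun v => Submodule.mem_top)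
      (fun u v _ => loss_strong hf v u) hz₀
      (c := L / n + lam * lamMax d What + 2 * (lam * lamMax d What))
      (θ := √(lam * lamMax d What / (μ / n))) (by linarith) (Real.sqrt_pos.2 (by positivity))
    refine ⟨ε₀, hε₀, fun ε hε hεε₀ => ?_⟩
    obtain ⟨s, T, hs1, hs, hT, hl₂, hθ, hany, hrun⟩ := H ε hε hεε₀
    simp only [if_neg hlt.not_ge, paramH, min_eq_right hlt.le, auxAccuracy]
    have hc := hp.ramProg hl (2 * (lam * lamMax d What)) (2 * (lam * lamMax d What) + L / n)
      (2 * (lam * lamMax d What) + μ / n) T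
      (restartLength (2 * (lam * lamMax d What)) (μ / n)) s
    have hgap : ∀ out, IsRAMRun (penalty lam What) (loss f) (2 * (lam * lamMax d What))
        (ε * (μ / n) / (864 ^ 2 * (L / n + lam * lamMax d What + 2 * (lam * lamMax d What)) ^ 2))
        (restartLength (2 * (lam * lamMax d What)) (μ / n)) s z₀ out →
        objective f lam What out - objective f lam What xStar ≤ ε := by
      intro out hout
      simpa only [objective, add_comm (penalty lam What _)] using hany out hout
    refine ⟨s, T, hs1, hgap, ?_, ?_, ?_⟩
    · rw [hc.val]; exact hrun
    · rw [hc.val]; exact hgap _ hrun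
    · rw [hc.comms, hc.grads]
      have := loss_inner_complexity hμf hμL hLp hlt.le hμp hμpL rfl (Nat.cast_nonneg s)
        (Nat.cast_nonneg (restartLength (2 * (lam * lamMax d What)) (μ / n))) hs
        restartLength_two_mul_le hT hl₂ hθ
      push_cast
      simpa using this
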